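/- All graphs are finite and simple. A set $S$ of vertices of a graph $G$ is $1$-sparse if each vertex of $S$ has at most one neighbour in $S$; it is $1$-dense if it is $1$-sparse in the complement of $G$, that is, if each vertex of $S$ is non-adjacent to at most one other vertex of $S$. A graph is perfect if in each of its induced subgraphs the chromatic number equals the clique number. Let $R_1^{\mathcal{PG}}(4,10)$ denote the smallest integer $n \ge 0$ such that every perfect graph on exactly $n$ vertices has a $1$-dense set of $4$ vertices or a $1$-sparse set of $10$ vertices. Theorem. $R_1^{\mathcal{PG}}(4,10)=22$. -/

import Mathlib

namespace DefectiveRamsey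

open Classical in
/-- A set `S` of vertices is `k`-sparse if each vertex of `S` has at most `k` neighbours in `S`. -/
def IsSparse {V : Type*} (G : SimpleGraph V) (k : ℕ) (S : Finset V) : Prop :=
  ∀ v ∈ S, (S.filter (fun w => G.Adj v w)).card ≤ k

/-- A set `D` of vertices is `k`-dense if it is `k`-sparse in the complement of `G`. -/
def IsDense {V : Type*} (G : SimpleGraph V) (k : ℕ) (D : Finset V) : Prop :=
  IsSparse Gᶜ k D

/-- A finite graph is perfect if the chromatic number of each induced subgraph equals the
clique number of that subgraph. -/
def IsPerfect {V : Type*} [Finite V] (G : SimpleGraph V) : Prop :=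
  ∀ s : Set V, (G.induce s).chromaticNumber = ((G.induce s).cliqueNum : ℕ∞)

/-- A class of finite graphs, given by its members on the vertex sets `Fin n`. -/
abbrev GraphClass : Type := (n : ℕ) → SimpleGraph (Fin n) → Prop

/-- The class of perfect graphs. -/
def perfectGraphs : GraphClass := fun _ G => IsPerfect G

/-- The orders `n` such that every graph of order `n` in the class `𝒢` has a `k`-dense `i`-set
or a `k`-sparse `j`-set. -/
def ramseyOrders (𝒢 : GraphClass) (k i j : ℕ) : Set ℕ :=
  {n | ∀ G : SimpleGraph (Fin n), 𝒢 n G →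
    (∃ D : Finset (Fin n), D.card = i ∧ IsDense G k D) ∨
    (∃ S : Finset (Fin n), S.card = j ∧ IsSparse G k S)}

/-- The `k`-defective Ramsey number of the class `𝒢` for `i` and `j` exists and equals `n`:
`n` is the smallest order such that every graph of that order in `𝒢` has a `k`-dense `i`-set or
a `k`-sparse `j`-set. -/
def IsRamseyNumber (𝒢 : GraphClass) (k i j n : ℕ) : Prop :=
  IsLeast (ramseyOrders 𝒢 k i j) n

end DefectiveRamsey

/-!
A four-element `1`-dense set is a set of four vertices that spans `K₄`, `K₄` minus an edge or `C₄`,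
so a graph without one has no 4-cycle at all, and two vertices have at most one common neighbour.
If the graph is moreover perfect, every triangle-free set of vertices induces a bipartite graph; in
particular there is no induced 5-cycle.

Upper bound. In such a graph the neighbourhood of a vertex `v` is `1`-sparse, and so is `v`
together with the vertices at distance two from it (`isSparse_secondNbr`): an edge between two
vertices at distance two with different parents would close a 4-cycle or an induced 5-cycle. Write
`s` for the largest size of a sparse set. The number of vertices at distance two is the sum of
`deg u - 1 - codeg v u` over the neighbours `u` of `v`, so this sum is at most `s - 1`. On the other
hand, if small graphs are known to have large sparse sets, then the closed neighbourhood of a vertex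
or of an edge cannot be small (`HasSparse.of_forces`), which bounds `deg u + deg v - codeg u v` from
below on edges. The two inequalities nearly contradict each other, and an induction along
`4 ↦ 3`, `6 ↦ 4`, `8 ↦ 5`, `10 ↦ 6`, `15 ↦ 8`, `22 ↦ 10` (order, size of a sparse set) goes through.
For `22` vertices the contradiction is immediate: a vertex whose degree `d` lies between `2` and `5`
has at least `d * (7 - d) ≥ 10` vertices at distance two, and a vertex of larger degree has even
more. For `10` and `15` vertices the degrees are first pinned down by the two inequalities, and the
remaining graphs are excluded by counting the vertices around a triangle
(`card_secondNbr_triangle`) or around the vertices of degree two.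

Lower bound. The extremal graph is the line graph of the Heawood graph, whose vertices are the `21`
flags of the Fano plane. As the Heawood graph has girth six, its line graph has no 4-cycle. An
induced subgraph either contains a triangle and is 3-coloured by a proper 3-edge-colouring of the
Heawood graph, or it is the union of two matchings and hence bipartite. A sparse set consists of
disjoint paths with one or two edges in the Heawood graph; it uses at least three of the `14`
vertices for every two edges, so it has at most nine elements.
-/

namespace DefectiveRamsey

section UpperBound

open Finset
open scoped Classical

variable {V : Type}

/-! ### Sparse sets, neighbourhoods and the working hypotheses -/

/-- The two properties on which the upper bound rests. The first, that two vertices have at most one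
common neighbour, holds if there is no `1`-dense set of four vertices; then cliques have at most
three vertices, and of perfection only the second property is needed: a set of vertices spanning no
triangle induces a bipartite graph. Both pass to induced subgraphs. -/
structure IsSquareFreePerfect (G : SimpleGraph V) : Prop where
  eq_of_common : ∀ ⦃a b c d : V⦄, a ≠ b → G.Adj a c → G.Adj b c → G.Adj a d → G.Adj b d → c = d
  bipartite_of_triangleFree : ∀ s : Set V,
    (∀ a ∈ s, ∀ b ∈ s, ∀ c ∈ s, G.Adj a b → G.Adj b c → ¬ G.Adj a c) →
    ∃ f : V → Bool, ∀ a ∈ s, ∀ b ∈ s, G.Adj a b → f a ≠ f b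

/-- `G` has a `1`-sparse set of at least `k` vertices. -/
def HasSparse (G : SimpleGraph V) (k : ℕ) : Prop :=
  ∃ S : Finset V, k ≤ S.card ∧ IsSparse G 1 S

theorem isSparse_one_iff {G : SimpleGraph V} {S : Finset V} :
    IsSparse G 1 S ↔ ∀ v ∈ S, ∀ a ∈ S, ∀ b ∈ S, G.Adj v a → G.Adj v b → a = b := by
  simp only [IsSparse, Finset.card_le_one, Finset.mem_filter]
  constructor
  · intro h v hv a ha b hb h1 h2
    exact h v hv a ⟨ha, h1⟩ b ⟨hb, h2⟩
  · rintro h v hv a ⟨ha, h1⟩ b ⟨hb, h2⟩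
    exact h v hv a ha b hb h1 h2

theorem IsSparse.subset {G : SimpleGraph V} {k : ℕ} {S T : Finset V} (h : IsSparse G k T)
    (hST : S ⊆ T) : IsSparse G k S := fun v hv =>
  (Finset.card_le_card (Finset.filter_subset_filter _ hST)).trans (h v (hST hv))

theorem isSparse_pair (G : SimpleGraph V) (a b : V) : IsSparse G 1 {a, b} := by
  rw [isSparse_one_iff]
  intro v hv x hx y hy h1 h2
  simp only [mem_insert, mem_singleton] at hv hx hy
  rcases hv with rfl | rfl <;> rcases hx with rfl | rfl <;> rcases hy with rfl | rfl <;>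
    first | rfl | exact absurd h1 (G.loopless.irrefl _) | exact absurd h2 (G.loopless.irrefl _)

theorem IsSparse.map {W : Type} {G : SimpleGraph V} {k : ℕ} (f : W ↪ V) {S : Finset W}
    (h : IsSparse (G.comap f) k S) : IsSparse G k (S.map f) := by
  intro v hv
  obtain ⟨w, hw, rfl⟩ := Finset.mem_map.1 hv
  rw [Finset.filter_map, Finset.card_map]
  exact h w hw

theorem IsSquareFreePerfect.comap {W : Type} {G : SimpleGraph V} (h : IsSquareFreePerfect G)
    (f : W ↪ V) : IsSquareFreePerfect (G.comap f) where
  eq_of_common a b c d hab h1 h2 h3 h4 :=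
    f.injective (h.eq_of_common (f.injective.ne hab) h1 h2 h3 h4)
  bipartite_of_triangleFree s hs := by
    obtain ⟨g, hg⟩ := h.bipartite_of_triangleFree (f '' s) (by
      rintro _ ⟨a, ha, rfl⟩ _ ⟨b, hb, rfl⟩ _ ⟨c, hc, rfl⟩
      exact hs a ha b hb c hc)
    exact ⟨g ∘ f, fun a ha b hb hab => hg _ ⟨a, ha, rfl⟩ _ ⟨b, hb, rfl⟩ hab⟩

/-- `Forces n k`: a graph satisfying `IsSquareFreePerfect` on `n` vertices has a `1`-sparse set of
at least `k` vertices. -/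
def Forces (n k : ℕ) : Prop :=
  ∀ (V : Type) [Fintype V] (G : SimpleGraph V), IsSquareFreePerfect G → Fintype.card V = n →
    HasSparse G k

theorem card_lt_of_not_hasSparse {G : SimpleGraph V} {m : ℕ}
    (hno : ¬ HasSparse G m) {T : Finset V} (hT : IsSparse G 1 T) : T.card < m := by
  by_contra h
  exact hno ⟨T, not_lt.1 h, hT⟩

theorem add_mul_le_sum {A : Finset V} {f : V → ℕ} {m : ℕ} {u : V} (hu : u ∈ A)
    (h : ∀ x ∈ A, x ≠ u → m ≤ f x) : f u + (A.card - 1) * m ≤ ∑ x ∈ A, f x := by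
  rw [← Finset.add_sum_erase _ _ hu, ← Finset.card_erase_of_mem hu, ← smul_eq_mul]
  gcongr
  refine Finset.card_nsmul_le_sum _ _ _ fun x hx => ?_
  rw [mem_erase] at hx
  exact h x hx.2 hx.1

theorem mul_le_sum {A : Finset V} {f : V → ℕ} {m : ℕ} (h : ∀ x ∈ A, m ≤ f x) :
    A.card * m ≤ ∑ x ∈ A, f x := by
  rw [← smul_eq_mul]
  exact Finset.card_nsmul_le_sum _ _ _ h

/-- There is no induced 5-cycle. -/
theorem IsSquareFreePerfect.not_isCycle_five {G : SimpleGraph V} (hG : IsSquareFreePerfect G)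
    {a b c d e : V} (h1 : G.Adj a b) (h2 : G.Adj b c) (h3 : G.Adj c d) (h4 : G.Adj d e)
    (h5 : G.Adj e a) (k1 : ¬ G.Adj a c) (k2 : ¬ G.Adj b d) (k3 : ¬ G.Adj c e) (k4 : ¬ G.Adj d a)
    (k5 : ¬ G.Adj e b) : False := by
  obtain ⟨f, hf⟩ := hG.bipartite_of_triangleFree {a, b, c, d, e} (by
    have := h1.symm; have := h2.symm; have := h3.symm; have := h4.symm; have := h5.symm
    have k1' := fun h : G.Adj c a => k1 h.symm
    have k2' := fun h : G.Adj d b => k2 h.symm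
    have k3' := fun h : G.Adj e c => k3 h.symm
    have k4' := fun h : G.Adj a d => k4 h.symm
    have k5' := fun h : G.Adj b e => k5 h.symm
    rintro x (rfl | rfl | rfl | rfl | rfl) y (rfl | rfl | rfl | rfl | rfl) z
      (rfl | rfl | rfl | rfl | rfl) <;> simp_all)
  have f1 := hf a (by simp) b (by simp) h1
  have f2 := hf b (by simp) c (by simp) h2
  have f3 := hf c (by simp) d (by simp) h3
  have f4 := hf d (by simp) e (by simp) h4
  have f5 := hf e (by simp) a (by simp) h5
  revert f1 f2 f3 f4 f5
  cases f a <;> cases f b <;> cases f c <;> cases f d <;> cases f e <;> simp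

variable [Fintype V]

/-- The neighbourhood of `v`. -/
noncomputable def nbr (G : SimpleGraph V) (v : V) : Finset V := univ.filter (G.Adj v)

@[simp] theorem mem_nbr {G : SimpleGraph V} {v w : V} : w ∈ nbr G v ↔ G.Adj v w := by simp [nbr]

/-- The degree of `v`, in a form that needs no decidability instance on `G`. -/
noncomputable def deg (G : SimpleGraph V) (v : V) : ℕ := (nbr G v).card

/-- The number of common neighbours of `v` and `u`. -/
noncomputable def codeg (G : SimpleGraph V) (v u : V) : ℕ := (nbr G v ∩ nbr G u).card

/-- For a neighbour `u` of `v`, the neighbours of `u` at distance two from `v`. -/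
noncomputable def children (G : SimpleGraph V) (v u : V) : Finset V :=
  (nbr G u \ nbr G v).erase v

/-- The vertices at distance two from `v`. -/
noncomputable def secondNbr (G : SimpleGraph V) (v : V) : Finset V :=
  (nbr G v).biUnion (children G v)

/-- The closed neighbourhood of a set of vertices. -/
noncomputable def closedNbr (G : SimpleGraph V) (T : Finset V) : Finset V := T ∪ T.biUnion (nbr G)

theorem codeg_comm (G : SimpleGraph V) (u v : V) : codeg G u v = codeg G v u := by
  rw [codeg, inter_comm, codeg]

/-- Deleting the closed neighbourhood of a sparse set `T` and taking a sparse set in what is left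
gives a sparse set that is larger by `|T|`. -/
theorem HasSparse.of_forces {G : SimpleGraph V} (hG : IsSquareFreePerfect G) {T : Finset V}
    (hT : IsSparse G 1 T) {n k : ℕ} (hF : Forces n k)
    (h : (closedNbr G T).card + n ≤ Fintype.card V) : HasSparse G (T.card + k) := by
  obtain ⟨U, hU, hUc⟩ : ∃ U ⊆ (closedNbr G T)ᶜ, U.card = n :=
    Finset.exists_subset_card_eq (by rw [Finset.card_compl]; omega)
  obtain ⟨S, hS, hSs⟩ := hF U (G.comap (Function.Embedding.subtype (· ∈ U)))
    (hG.comap _) (by simp [hUc])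
  have hSs := hSs.map
  set S' := S.map (Function.Embedding.subtype (· ∈ U)) with hS'
  have hSU : ∀ x ∈ S', x ∉ T ∧ ∀ t ∈ T, ¬ G.Adj t x := by
    intro x hx
    obtain ⟨y, _, rfl⟩ := Finset.mem_map.1 hx
    have := hU y.2
    simp only [closedNbr, mem_compl, mem_union, mem_biUnion, mem_nbr, not_or, not_exists,
      not_and] at this
    exact this
  refine ⟨T ∪ S', ?_, ?_⟩
  · rw [Finset.card_union_of_disjoint, hS', Finset.card_map]
    · omega
    · rw [Finset.disjoint_right]
      exact fun x hx => (hSU x hx).1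
  · rw [isSparse_one_iff] at hT hSs ⊢
    intro v hv a ha b hb h1 h2
    simp only [mem_union] at hv ha hb
    rcases hv with hv | hv
    · have ha' : a ∈ T := ha.resolve_right fun h => (hSU a h).2 v hv h1
      have hb' : b ∈ T := hb.resolve_right fun h => (hSU b h).2 v hv h2
      exact hT v hv a ha' b hb' h1 h2
    · have ha' : a ∈ S' := ha.resolve_left fun h => (hSU v hv).2 a h h1.symm
      have hb' : b ∈ S' := hb.resolve_left fun h => (hSU v hv).2 b h h2.symm
      exact hSs v hv a ha' b hb' h1 h2

/-! ### Distance two from a vertex -/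

namespace IsSquareFreePerfect

variable {G : SimpleGraph V}

theorem codeg_le_one (hG : IsSquareFreePerfect G) {u v : V} (h : u ≠ v) : codeg G u v ≤ 1 := by
  rw [codeg, Finset.card_le_one]
  intro a ha b hb
  simp only [mem_inter, mem_nbr] at ha hb
  exact hG.eq_of_common h ha.1 ha.2 hb.1 hb.2

theorem mem_children {v u w : V} : w ∈ children G v u ↔ w ≠ v ∧ G.Adj u w ∧ ¬ G.Adj v w := by
  simp [children]

theorem mem_secondNbr {v w : V} :
    w ∈ secondNbr G v ↔ w ≠ v ∧ ¬ G.Adj v w ∧ ∃ u, G.Adj v u ∧ G.Adj u w := by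
  simp only [secondNbr, mem_biUnion, mem_nbr, mem_children]
  tauto

theorem deg_eq {v u : V} (h : G.Adj v u) : deg G u = 1 + codeg G v u + (children G v u).card := by
  have h1 : v ∈ nbr G u \ nbr G v := by simp [h.symm]
  have h2 := Finset.card_erase_add_one h1
  have h3 := Finset.card_sdiff_add_card_inter (nbr G u) (nbr G v)
  rw [deg, ← h3, inter_comm, ← h2, codeg, children]
  ring

theorem card_secondNbr (hG : IsSquareFreePerfect G) (v : V) :
    (secondNbr G v).card = ∑ u ∈ nbr G v, (children G v u).card := by
  refine Finset.card_biUnion fun u hu u' hu' hne => ?_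
  rw [Function.onFun, Finset.disjoint_left]
  intro w hw hw'
  rw [mem_children] at hw hw'
  rw [mem_coe, mem_nbr] at hu hu'
  exact hne (hG.eq_of_common hw.1.symm hu hw.2.1.symm hu' hw'.2.1.symm)

theorem isSparse_nbr (hG : IsSquareFreePerfect G) (v : V) : IsSparse G 1 (nbr G v) := by
  rw [isSparse_one_iff]
  intro u hu a ha b hb h1 h2
  rw [mem_nbr] at hu ha hb
  exact hG.eq_of_common hu.ne ha h1 hb h2

/-- An edge between two vertices at distance two from `v` with different parents would close a
4-cycle or an induced 5-cycle, so `v` and the vertices at distance two from it form a sparse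
set. -/
theorem isSparse_secondNbr (hG : IsSquareFreePerfect G) (v : V) :
    IsSparse G 1 (insert v (secondNbr G v)) := by
  have key : ∀ u w w', G.Adj v u → G.Adj u w → w ≠ v → ¬ G.Adj v w → w' ∈ secondNbr G v →
      G.Adj w w' → G.Adj u w' := by
    intro u w w' hu huw hwv hvw hw' hww'
    obtain ⟨hw'v, hvw', u', hu', hu'w'⟩ := mem_secondNbr.1 hw'
    by_contra hcon
    have hne : u ≠ u' := by rintro rfl; exact hcon hu'w'
    have hu'w : ¬ G.Adj u' w := fun h =>
      hne (hG.eq_of_common hwv.symm hu huw.symm hu' h.symm)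
    have huu' : ¬ G.Adj u u' := by
      intro h
      have : w = u' := hG.eq_of_common (a := u) (b := w') (by rintro rfl; exact hvw' hu)
        huw hww'.symm h hu'w'.symm
      subst this
      exact hvw hu'
    exact hG.not_isCycle_five hu huw hww' hu'w'.symm hu'.symm hvw hcon (fun h => hu'w h.symm)
      (fun h => hvw' h.symm) (fun h => huu' h.symm)
  rw [isSparse_one_iff]
  intro w hw a ha b hb h1 h2
  have hv : ∀ x ∈ insert v (secondNbr G v), ¬ G.Adj v x := by
    intro x hx
    rcases mem_insert.1 hx with rfl | hx
    · exact G.loopless.irrefl _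
    · exact (mem_secondNbr.1 hx).2.1
  have hwv : w ≠ v := by rintro rfl; exact hv a ha h1
  have ha' : a ∈ secondNbr G v :=
    (mem_insert.1 ha).resolve_left (by rintro rfl; exact hv w hw h1.symm)
  have hb' : b ∈ secondNbr G v :=
    (mem_insert.1 hb).resolve_left (by rintro rfl; exact hv w hw h2.symm)
  obtain ⟨_, hvw, u, hu, huw⟩ := mem_secondNbr.1 ((mem_insert.1 hw).resolve_left hwv)
  exact hG.eq_of_common huw.ne (key u w a hu huw hwv hvw ha' h1) h1
    (key u w b hu huw hwv hvw hb' h2) h2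

/-- Each vertex outside a triangle is at distance two from at most two of its corners, and from at
most one of them unless it is a neighbour of the triangle. -/
theorem card_secondNbr_triangle (hG : IsSquareFreePerfect G) {x y z : V}
    (hxy : G.Adj x y) (hyz : G.Adj y z) (hxz : G.Adj x z) :
    (secondNbr G x).card + (secondNbr G y).card + (secondNbr G z).card + 9 ≤
      Fintype.card V + deg G x + deg G y + deg G z := by
  have key : ∀ x y z p, G.Adj x y → G.Adj y z → G.Adj x z → p ∈ secondNbr G x →
      p ∈ secondNbr G y → ¬ G.Adj z p → False := by
    intro x y z p hxy hyz hxz hx hy hz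
    obtain ⟨hpx, hxp, u, hxu, hup⟩ := mem_secondNbr.1 hx
    obtain ⟨hpy, hyp, u', hyu', hu'p⟩ := mem_secondNbr.1 hy
    have hyu : ¬ G.Adj y u := by
      intro h
      have : z = u := hG.eq_of_common hxy.ne hxz hyz hxu h
      subst this
      exact hz hup
    have hxu' : ¬ G.Adj x u' := by
      intro h
      have : z = u' := hG.eq_of_common hxy.ne hxz hyz h hyu'
      subst this
      exact hz hu'p
    have huu' : ¬ G.Adj u u' := by
      intro h
      have : u = y := hG.eq_of_common (a := x) (b := u') (by rintro rfl; exact hxp hu'p)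
        hxu h.symm hxy hyu'.symm
      subst this
      exact hyp hup
    exact hG.not_isCycle_five hup.symm hxu.symm hxy hyu' hu'p (fun h => hxp h.symm)
      (fun h => hyu h.symm) hxu' hyp (fun h => huu' h.symm)
  have e : ∀ A : Finset V, A.card = ∑ p, if p ∈ A then 1 else 0 := by intro A; simp
  have h3 : ({x, y, z} : Finset V).card = 3 := by
    rw [Finset.card_eq_three]
    exact ⟨x, y, z, hxy.ne, hxz.ne, hyz.ne, rfl⟩
  have : (secondNbr G x).card + (secondNbr G y).card + (secondNbr G z).card
      + 3 * ({x, y, z} : Finset V).card ≤ (univ : Finset V).card + deg G x + deg G y + deg G z := by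
    simp only [deg]
    rw [e (secondNbr G x), e (secondNbr G y), e (secondNbr G z), e {x, y, z}, e univ, e (nbr G x),
      e (nbr G y), e (nbr G z)]
    simp only [Finset.mul_sum, ← Finset.sum_add_distrib]
    refine Finset.sum_le_sum fun p _ => ?_
    by_cases hp : p ∈ ({x, y, z} : Finset V)
    · have hmem : ∀ a b, b ∈ ({x, y, z} : Finset V) → a ∈ ({x, y, z} : Finset V) →
          a ∉ secondNbr G b ∧ (a ≠ b → a ∈ nbr G b) := by
        intro a b hb ha
        simp only [mem_insert, mem_singleton] at ha hb
        rw [mem_secondNbr, mem_nbr]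
        have := hxy.symm; have := hyz.symm; have := hxz.symm
        rcases ha with rfl | rfl | rfl <;> rcases hb with rfl | rfl | rfl <;> simp_all
      rw [if_neg (hmem p x (by simp) hp).1, if_neg (hmem p y (by simp) hp).1,
        if_neg (hmem p z (by simp) hp).1, if_pos hp]
      simp only [mem_insert, mem_singleton] at hp
      have := hxy.symm; have := hyz.symm; have := hxz.symm
      rcases hp with rfl | rfl | rfl <;> simp_all
    · have k1 := key x y z p hxy hyz hxz
      have k2 := key y z x p hyz hxz.symm hxy.symm
      have k3 := key x z y p hxz hyz.symm hxy
      have n1 : p ∈ secondNbr G x → ¬ G.Adj x p := fun h => (mem_secondNbr.1 h).2.1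
      have n2 : p ∈ secondNbr G y → ¬ G.Adj y p := fun h => (mem_secondNbr.1 h).2.1
      have n3 : p ∈ secondNbr G z → ¬ G.Adj z p := fun h => (mem_secondNbr.1 h).2.1
      rw [if_neg hp]
      simp only [mem_nbr, mem_univ, if_true]
      split_ifs <;> simp_all
  rw [h3, Finset.card_univ] at this
  omega

/-- The neighbourhood of `v` spans a matching: `π` exchanges the ends of its edges and fixes the
other neighbours of `v`. -/
theorem exists_partner (hG : IsSquareFreePerfect G) (v : V) : ∃ π : V → V,
    ∀ u ∈ nbr G v, π u ∈ nbr G v ∧ π (π u) = u ∧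
      (codeg G v u = 0 → π u = u) ∧ (codeg G v u ≠ 0 → G.Adj u (π u)) := by
  have hex : ∀ u, ∃ u', (codeg G v u = 0 → u' = u) ∧
      (codeg G v u ≠ 0 → G.Adj v u' ∧ G.Adj u u') := by
    intro u
    by_cases h : codeg G v u = 0
    · exact ⟨u, fun _ => rfl, fun h' => absurd h h'⟩
    · obtain ⟨u', hu'⟩ := Finset.card_pos.1 (Nat.pos_of_ne_zero h)
      rw [mem_inter, mem_nbr, mem_nbr] at hu'
      exact ⟨u', fun h' => absurd h' h, fun _ => hu'⟩
  choose π h0 h1 using hex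
  refine ⟨π, fun u hu => ?_⟩
  have hu' := mem_nbr.1 hu
  by_cases h : codeg G v u = 0
  · have := h0 u h
    simp [this, hu', h]
  · obtain ⟨a, b⟩ := h1 u h
    have h' : codeg G v (π u) ≠ 0 :=
      (Finset.card_pos.2 ⟨u, by simp [hu', b.symm]⟩).ne'
    obtain ⟨a', b'⟩ := h1 _ h'
    exact ⟨mem_nbr.2 a, hG.eq_of_common a.ne a' b' hu' b.symm, fun h'' => absurd h'' h, fun _ => b⟩

theorem even_card_codeg (hG : IsSquareFreePerfect G) (v : V) :
    Even ((nbr G v).filter (fun u => codeg G v u ≠ 0)).card := by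
  obtain ⟨π, hπ⟩ := hG.exists_partner v
  have : ∑ u ∈ (nbr G v).filter (fun u => codeg G v u ≠ 0), (1 : ZMod 2) = 0 := by
    refine Finset.sum_involution (fun u _ => π u) (fun _ _ => by decide) ?_ ?_ ?_
    · intro u hu _ h
      rw [mem_filter] at hu
      have := (hπ u hu.1).2.2.2 hu.2
      rw [h] at this
      exact G.loopless.irrefl _ this
    · intro u hu
      rw [mem_filter] at hu ⊢
      refine ⟨(hπ u hu.1).1, (Finset.card_pos.2 ⟨u, ?_⟩).ne'⟩
      rw [mem_inter]
      exact ⟨hu.1, mem_nbr.2 ((hπ u hu.1).2.2.2 hu.2).symm⟩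
    · intro u hu
      exact (hπ u (mem_filter.1 hu).1).2.1
  rw [Finset.sum_const, nsmul_one] at this
  exact (ZMod.natCast_eq_zero_iff_even).1 this

end IsSquareFreePerfect

variable {G : SimpleGraph V}

/-! ### Inequalities for a graph without large sparse sets -/

theorem card_lt_closedNbr (hG : IsSquareFreePerfect G) {m n k : ℕ} (hno : ¬ HasSparse G m)
    (hF : Forces n k) {T : Finset V} (hT : IsSparse G 1 T) (hk : T.card + k = m) :
    Fintype.card V < (closedNbr G T).card + n := by
  by_contra h
  exact hno (hk ▸ HasSparse.of_forces hG hT hF (not_lt.1 h))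

theorem deg_lt (hG : IsSquareFreePerfect G) {m : ℕ} (hno : ¬ HasSparse G m) (v : V) :
    deg G v < m :=
  card_lt_of_not_hasSparse hno (hG.isSparse_nbr v)

theorem sum_children_lt (hG : IsSquareFreePerfect G) {m : ℕ} (hno : ¬ HasSparse G m) (v : V) :
    ∑ u ∈ nbr G v, (children G v u).card + 1 < m := by
  have h := card_lt_of_not_hasSparse hno (hG.isSparse_secondNbr v)
  rwa [Finset.card_insert_of_notMem (by simp [IsSquareFreePerfect.mem_secondNbr]),
    hG.card_secondNbr] at h

theorem card_lt_deg_add (hG : IsSquareFreePerfect G) {n k : ℕ} (hno : ¬ HasSparse G (k + 1))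
    (hF : Forces n k) (v : V) : Fintype.card V < deg G v + 1 + n := by
  have hT : IsSparse G 1 {v} := by simpa using isSparse_pair G v v
  have h := card_lt_closedNbr hG hno hF hT (by simp; ring)
  rwa [closedNbr, Finset.singleton_biUnion, Finset.card_union_of_disjoint (by simp),
    Finset.card_singleton, add_comm 1] at h

theorem card_lt_deg_add_deg (hG : IsSquareFreePerfect G) {n k : ℕ}
    (hno : ¬ HasSparse G (k + 2)) (hF : Forces n k) {u v : V} (huv : G.Adj u v) :
    Fintype.card V + codeg G u v < deg G u + deg G v + n := by
  have h := card_lt_closedNbr hG hno hF (isSparse_pair G u v)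
    (by rw [Finset.card_pair huv.ne]; ring)
  have h1 : closedNbr G {u, v} = nbr G u ∪ nbr G v := by
    rw [closedNbr, Finset.union_eq_right.2]
    · simp [Finset.biUnion_insert]
    · intro x hx
      simp only [mem_insert, mem_singleton] at hx
      rw [mem_biUnion]
      rcases hx with rfl | rfl
      · exact ⟨v, by simp, by simpa using huv.symm⟩
      · exact ⟨u, by simp, by simpa using huv⟩
  have h2 := Finset.card_union_add_card_inter (nbr G u) (nbr G v)
  rw [h1] at h
  simp only [deg, codeg]
  omega

/-- Two neighbours of a common vertex `v` cannot both have very small degree. -/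
theorem card_lt_of_common (hG : IsSquareFreePerfect G) {n k : ℕ}
    (hno : ¬ HasSparse G (k + 2)) (hF : Forces n k) {a b v : V} (hab : a ≠ b)
    (ha : G.Adj v a) (hb : G.Adj v b) :
    Fintype.card V < deg G a + deg G b + 1 + n := by
  have h := card_lt_closedNbr hG hno hF (isSparse_pair G a b)
    (by rw [Finset.card_pair hab]; ring)
  have h1 : closedNbr G {a, b} = {a, b} ∪ (nbr G a ∪ nbr G b) := by
    simp [closedNbr, Finset.biUnion_insert]
  have h2 := Finset.card_union_add_card_inter (nbr G a) (nbr G b)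
  have h3 : 0 < (nbr G a ∩ nbr G b).card :=
    Finset.card_pos.2 ⟨v, by simp [ha.symm, hb.symm]⟩
  have h4 := Finset.card_union_le {a, b} (nbr G a ∪ nbr G b)
  rw [Finset.card_pair hab] at h4
  rw [h1] at h
  simp only [deg]
  omega

theorem exists_adj_of_deg_pos {v : V} (h : 0 < deg G v) : ∃ u, G.Adj v u := by
  obtain ⟨u, hu⟩ := Finset.card_pos.1 h
  exact ⟨u, mem_nbr.1 hu⟩

theorem deg_pos_of_adj {u v : V} (h : G.Adj v u) : 0 < deg G u :=
  Finset.card_pos.2 ⟨v, mem_nbr.2 h.symm⟩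

/-! ### Graphs with up to eight vertices -/

theorem Forces.of_le_two {n : ℕ} (hn : n ≤ 2) : Forces n n := by
  intro V _ G _ hV
  refine ⟨univ, by rw [Finset.card_univ, hV], fun v _ => ?_⟩
  have h : (univ.filter (fun w => G.Adj v w)) ⊆ univ.erase v := by
    intro w hw
    rw [mem_filter] at hw
    rw [mem_erase]
    exact ⟨hw.2.ne', hw.1⟩
  have h1 := Finset.card_le_card h
  rw [Finset.card_erase_of_mem (mem_univ v), Finset.card_univ, hV] at h1
  convert h1.trans (by omega : n - 1 ≤ 1)

theorem forces_four_three : Forces 4 3 := by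
  intro V _ G hG hV
  by_contra hno
  have hd : ∀ v, deg G v = 2 := fun v => by
    have h1 := deg_lt hG hno v
    have h2 := card_lt_deg_add hG hno (Forces.of_le_two le_rfl) v
    omega
  obtain ⟨v⟩ : Nonempty V := Fintype.card_pos_iff.1 (by omega)
  have h1 := sum_children_lt hG hno v
  have h2 : (nbr G v).card * 1 ≤ ∑ u ∈ nbr G v, (children G v u).card := by
    refine mul_le_sum fun u hu => ?_
    have hu := mem_nbr.1 hu
    have h3 := card_lt_deg_add_deg hG hno (Forces.of_le_two one_le_two) hu
    have h4 := IsSquareFreePerfect.deg_eq hu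
    rw [hd, hd] at h3
    rw [hd] at h4
    omega
  have := hd v
  rw [deg] at this
  omega

theorem forces_six_four : Forces 6 4 := by
  intro V _ G hG hV
  by_contra hno
  have hlow : ∀ v, 2 ≤ deg G v := fun v => by
    have := card_lt_deg_add hG hno forces_four_three v
    omega
  have hedge : ∀ {u v}, G.Adj u v → 5 + codeg G u v ≤ deg G u + deg G v := fun huv => by
    have := card_lt_deg_add_deg hG hno (Forces.of_le_two le_rfl) huv
    omega
  have hlow3 : ∀ v, 3 ≤ deg G v := by
    intro v
    by_contra hv
    have h2 : deg G v = 2 := by have := hlow v; omega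
    have h1 := sum_children_lt hG hno v
    have h3 : (nbr G v).card * 2 ≤ ∑ u ∈ nbr G v, (children G v u).card := by
      refine mul_le_sum fun u hu => ?_
      have hu := mem_nbr.1 hu
      have := hedge hu
      have := IsSquareFreePerfect.deg_eq hu
      omega
    rw [deg] at h2
    omega
  obtain ⟨v⟩ : Nonempty V := Fintype.card_pos_iff.1 (by omega)
  have h1 := sum_children_lt hG hno v
  have h3 : (nbr G v).card * 1 ≤ ∑ u ∈ nbr G v, (children G v u).card := by
    refine mul_le_sum fun u hu => ?_
    have hu := mem_nbr.1 hu
    have := hlow3 u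
    have := hG.codeg_le_one hu.ne
    have := IsSquareFreePerfect.deg_eq hu
    omega
  have := hlow3 v
  rw [deg] at this
  omega

theorem forces_eight_five : Forces 8 5 := by
  intro V _ G hG hV
  by_contra hno
  have hlow : ∀ v, 2 ≤ deg G v := fun v => by
    have := card_lt_deg_add hG hno forces_six_four v
    omega
  have hedge : ∀ {u v}, G.Adj u v → 5 + codeg G u v ≤ deg G u + deg G v := fun huv => by
    have := card_lt_deg_add_deg hG hno forces_four_three huv
    omega
  have hlow3 : ∀ v, 3 ≤ deg G v := by
    intro v
    by_contra hv
    have h2 : deg G v = 2 := by have := hlow v; omega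
    have h1 := sum_children_lt hG hno v
    have h3 : (nbr G v).card * 2 ≤ ∑ u ∈ nbr G v, (children G v u).card := by
      refine mul_le_sum fun u hu => ?_
      have hu := mem_nbr.1 hu
      have := hedge hu
      have := IsSquareFreePerfect.deg_eq hu
      omega
    rw [deg] at h2
    omega
  obtain ⟨v⟩ : Nonempty V := Fintype.card_pos_iff.1 (by omega)
  have h1 := sum_children_lt hG hno v
  have hw : ∀ u ∈ nbr G v, 2 ≤ (children G v u).card + codeg G v u := fun u hu => by
    have := hlow3 u
    have := IsSquareFreePerfect.deg_eq (mem_nbr.1 hu)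
    omega
  have hc : ∀ u ∈ nbr G v, codeg G v u ≤ 1 := fun u hu => hG.codeg_le_one (mem_nbr.1 hu).ne
  have h3 : (nbr G v).card * 1 ≤ ∑ u ∈ nbr G v, (children G v u).card :=
    mul_le_sum fun u hu => by have := hw u hu; have := hc u hu; omega
  have hv3 : (nbr G v).card = 3 := by have := hlow3 v; rw [deg] at this; omega
  -- Each of the three neighbours has a single child, so it lies on an edge within the
  -- neighbourhood; but the number of such neighbours is even.
  have h4 : (nbr G v).filter (fun u => codeg G v u ≠ 0) = nbr G v := by
    refine Finset.filter_true_of_mem fun u hu h0 => ?_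
    have := hw u hu
    have := add_mul_le_sum (f := fun u => (children G v u).card) (m := 1) hu
      fun x hx _ => by have := hw x hx; have := hc x hx; omega
    rw [hv3] at this
    omega
  have h5 := hG.even_card_codeg v
  rw [h4, hv3] at h5
  exact absurd h5 (by decide)

/-! ### Graphs with ten vertices -/

theorem exists_adj_ne {v : V} (a : V) (h : 2 ≤ deg G v) : ∃ w, G.Adj v w ∧ w ≠ a := by
  obtain ⟨w, hw⟩ : ((nbr G v).erase a).Nonempty := by
    rw [← Finset.card_pos]
    have := Finset.pred_card_le_card_erase (a := a) (s := nbr G v)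
    rw [deg] at h
    omega
  rw [mem_erase, mem_nbr] at hw
  exact ⟨w, hw.2, hw.1⟩

theorem exists_adj_ne_ne {v : V} (a b : V) (h : 3 ≤ deg G v) :
    ∃ w, G.Adj v w ∧ w ≠ a ∧ w ≠ b := by
  obtain ⟨w, hw⟩ : (((nbr G v).erase a).erase b).Nonempty := by
    rw [← Finset.card_pos]
    have := Finset.pred_card_le_card_erase (a := a) (s := nbr G v)
    have := Finset.pred_card_le_card_erase (a := b) (s := (nbr G v).erase a)
    rw [deg] at h
    omega
  rw [mem_erase, mem_erase, mem_nbr] at hw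
  exact ⟨w, hw.2.2, hw.2.1, hw.1⟩

theorem eq_of_adj_of_deg_le_two {v a b w : V} (h : deg G v ≤ 2) (ha : G.Adj v a)
    (hb : G.Adj v b) (hab : a ≠ b) (hw : G.Adj v w) : w = a ∨ w = b := by
  have h1 : {a, b} = nbr G v :=
    Finset.eq_of_subset_of_card_le (by simp [insert_subset_iff, ha, hb])
      (by rwa [Finset.card_pair hab])
  have h2 := mem_nbr.2 hw
  simpa [← h1] using h2

theorem eq_of_adj_of_deg_le_three {v a b c w : V} (h : deg G v ≤ 3) (ha : G.Adj v a)
    (hb : G.Adj v b) (hc : G.Adj v c) (hab : a ≠ b) (hac : a ≠ c) (hbc : b ≠ c)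
    (hw : G.Adj v w) : w = a ∨ w = b ∨ w = c := by
  have h1 : {a, b, c} = nbr G v :=
    Finset.eq_of_subset_of_card_le (by simp [insert_subset_iff, ha, hb, hc])
      (by rwa [Finset.card_eq_three.2 ⟨a, b, c, hab, hac, hbc, rfl⟩])
  have h2 := mem_nbr.2 hw
  simpa [← h1] using h2

theorem deg_le_two_of_forall {v a b : V} (h : ∀ w, G.Adj v w → w = a ∨ w = b) :
    deg G v ≤ 2 := by
  have h1 : nbr G v ⊆ {a, b} := fun w hw => by simpa using h w (mem_nbr.1 hw)
  exact (Finset.card_le_card h1).trans Finset.card_le_two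

/-- In a ten-vertex graph with all degrees `2` or `3` and no edge joining vertices of degree `2`,
two of the vertices attached to a triangle cannot have degree `2`: the four vertices at distance at
least two from the triangle cannot reach degree `2` or `3` without closing a 4-cycle, an induced
5-cycle or an edge between two vertices of degree `2`. -/
theorem not_two_attached_of_card_ten (hG : IsSquareFreePerfect G) (hV : Fintype.card V = 10)
    (hd : ∀ v, deg G v = 2 ∨ deg G v = 3)
    (hedge : ∀ {u v}, G.Adj u v → 5 + codeg G u v ≤ deg G u + deg G v)
    {x y z x' y' : V} (hxy : G.Adj x y) (hyz : G.Adj y z) (hxz : G.Adj x z)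
    (hx : deg G x = 3) (hy : deg G y = 3) (hz : deg G z = 3)
    (hxx : G.Adj x x') (hyy : G.Adj y y') (hx'y : x' ≠ y) (hx'z : x' ≠ z) (hy'x : y' ≠ x)
    (hy'z : y' ≠ z) (hdx : deg G x' = 2) (hdy : deg G y' = 2) : False := by
  have c4 : ∀ {a b c d : V}, G.Adj a c → G.Adj c b → G.Adj b d → G.Adj d a → a = b ∨ c = d := by
    intro a b c d h1 h2 h3 h4
    by_cases hab : a = b
    · exact Or.inl hab
    · exact Or.inr (hG.eq_of_common hab h1 h2.symm h4.symm h3)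
  obtain ⟨z', hzz, hz'x, hz'y⟩ := exists_adj_ne_ne x y hz.ge
  obtain ⟨m, hxm, hmx⟩ := exists_adj_ne x hdx.ge
  obtain ⟨m', hym, hmy⟩ := exists_adj_ne y hdy.ge
  have Nx : ∀ w, G.Adj x w → w = y ∨ w = z ∨ w = x' := fun w =>
    eq_of_adj_of_deg_le_three hx.le hxy hxz hxx hyz.ne hx'y.symm hx'z.symm
  have Ny : ∀ w, G.Adj y w → w = x ∨ w = z ∨ w = y' := fun w =>
    eq_of_adj_of_deg_le_three hy.le hxy.symm hyz hyy hxz.ne hy'x.symm hy'z.symm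
  have Nz : ∀ w, G.Adj z w → w = x ∨ w = y ∨ w = z' := fun w =>
    eq_of_adj_of_deg_le_three hz.le hxz.symm hyz.symm hzz hxy.ne hz'x.symm hz'y.symm
  have Nx' : ∀ w, G.Adj x' w → w = x ∨ w = m := fun w =>
    eq_of_adj_of_deg_le_two hdx.le hxx.symm hxm hmx.symm
  have Ny' : ∀ w, G.Adj y' w → w = y ∨ w = m' := fun w =>
    eq_of_adj_of_deg_le_two hdy.le hyy.symm hym hmy.symm
  have hm : deg G m = 3 := by have := hedge hxm; have := hd m; omega
  have hm' : deg G m' = 3 := by have := hedge hym; have := hd m'; omega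
  have n1 : ¬ G.Adj x' y := fun h => (c4 hxx h hyz hxz.symm).elim hxy.ne hx'z
  have n2 : ¬ G.Adj x' z := fun h => (c4 hxx h hyz.symm hxy.symm).elim hxz.ne hx'y
  have n3 : ¬ G.Adj y' x := fun h => (c4 hyy h hxz hyz.symm).elim hxy.ne' hy'z
  have n4 : ¬ G.Adj y' z := fun h => (c4 hyy h hxz.symm hxy).elim hyz.ne hy'x
  have n5 : ¬ G.Adj z' x := fun h => (c4 hzz h hxy hyz).elim hxz.ne' hz'y
  have n6 : ¬ G.Adj z' y := fun h => (c4 hzz h hxy.symm hxz).elim hyz.ne' hz'x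
  have d1 : x' ≠ y' := by rintro rfl; exact n1 hyy.symm
  have d2 : x' ≠ z' := by rintro rfl; exact n2 hzz.symm
  have d3 : y' ≠ z' := by rintro rfl; exact n4 hzz.symm
  have n7 : ¬ G.Adj x' y' := fun h => (c4 hxx h hyy.symm hxy.symm).elim hy'x.symm hx'y
  have n8 : ¬ G.Adj x' z' := fun h => (c4 hxx h hzz.symm hxz.symm).elim hz'x.symm hx'z
  have n9 : ¬ G.Adj y' z' := fun h => (c4 hyy h hzz.symm hyz.symm).elim hz'y.symm hy'z
  have e1 : m ≠ y := by rintro rfl; exact n1 hxm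
  have e2 : m ≠ z := by rintro rfl; exact n2 hxm
  have e3 : m ≠ y' := by rintro rfl; exact n7 hxm
  have e4 : m ≠ z' := by rintro rfl; exact n8 hxm
  have e5 : m' ≠ x := by rintro rfl; exact n3 hym
  have e6 : m' ≠ z := by rintro rfl; exact n4 hym
  have e7 : m' ≠ x' := by rintro rfl; exact n7 hym.symm
  have e8 : m' ≠ z' := by rintro rfl; exact n9 hym
  have a1 : ¬ G.Adj m x := fun h => by
    rcases Nx _ h.symm with h | h | h
    exacts [e1 h, e2 h, hxm.ne' h]
  have a2 : ¬ G.Adj m y := fun h => by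
    rcases Ny _ h.symm with h | h | h
    exacts [hmx h, e2 h, e3 h]
  have a3 : ¬ G.Adj m z := fun h => by
    rcases Nz _ h.symm with h | h | h
    exacts [hmx h, e1 h, e4 h]
  have b1 : ¬ G.Adj m' x := fun h => by
    rcases Nx _ h.symm with h | h | h
    exacts [hmy h, e6 h, e7 h]
  have b2 : ¬ G.Adj m' y := fun h => by
    rcases Ny _ h.symm with h | h | h
    exacts [e5 h, e6 h, hym.ne' h]
  have b3 : ¬ G.Adj m' z := fun h => by
    rcases Nz _ h.symm with h | h | h
    exacts [e5 h, hmy h, e8 h]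
  have dm : m ≠ m' := by
    rintro rfl
    exact hG.not_isCycle_five hxm hym.symm hyy.symm hxy.symm hxx n7 a2 n3 (fun h => n1 h.symm)
      (fun h => a1 h.symm)
  have a4 : ¬ G.Adj m z' := fun h =>
    hG.not_isCycle_five hxm h hzz.symm hxz.symm hxx n8 a3 n5 (fun h => n2 h.symm)
      (fun h => a1 h.symm)
  have b4 : ¬ G.Adj m' z' := fun h =>
    hG.not_isCycle_five hym h hzz.symm hyz.symm hyy n9 b3 n6 (fun h => n4 h.symm)
      (fun h => b2 h.symm)
  have a5 : ¬ G.Adj m y' := fun h => by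
    rcases Ny' _ h.symm with h | h
    exacts [e1 h, dm h]
  have b5 : ¬ G.Adj m' x' := fun h => by
    rcases Nx' _ h.symm with h | h
    exacts [e5 h, dm h.symm]
  -- The two remaining vertices.
  obtain ⟨p, q, hpq, hO⟩ : ∃ p q, p ≠ q ∧
      (univ \ {x, y, z, x', y', z', m, m'} : Finset V) = {p, q} := by
    rw [← Finset.card_eq_two, Finset.card_sdiff_of_subset (subset_univ _), Finset.card_univ, hV]
    have : ({x, y, z, x', y', z', m, m'} : Finset V).card = 8 := by
      have := hxy.ne; have := hxz.ne; have := hyz.ne; have := hxx.ne; have := hyy.ne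
      have := hzz.ne; have := hxm.ne; have := hym.ne
      repeat rw [Finset.card_insert_of_notMem (by
        simp only [mem_insert, mem_singleton, not_or]; grind)]
      simp
    rw [this]
  have hO' : ∀ w, (w ≠ x ∧ w ≠ y ∧ w ≠ z ∧ w ≠ x' ∧ w ≠ y' ∧ w ≠ z' ∧ w ≠ m ∧ w ≠ m') ↔
      w = p ∨ w = q := by
    intro w
    have := Finset.ext_iff.1 hO w
    simpa using this
  clear hO
  have main : ∀ p q, p ≠ q → (∀ w, (w ≠ x ∧ w ≠ y ∧ w ≠ z ∧ w ≠ x' ∧ w ≠ y' ∧ w ≠ z' ∧ w ≠ m ∧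
      w ≠ m') ↔ w = p ∨ w = q) → G.Adj m p → False := by
    clear hpq hO' p q
    intro p q hpq hO hmp
    have hp := (hO p).2 (Or.inl rfl)
    have hq := (hO q).2 (Or.inr rfl)
    have Nm : ∀ w, G.Adj m w → w = x' ∨ w = m' ∨ w = p ∨ w = q := by
      intro w hw
      have := hO w
      have := hw.ne
      by_contra hcon
      clear c4 hedge hd
      grind
    have Nm' : ∀ w, G.Adj m' w → w = y' ∨ w = m ∨ w = p ∨ w = q := by
      intro w hw
      have := hO w
      have := hw.ne
      by_contra hcon
      clear c4 hedge hd
      grind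
    have hmm : G.Adj m m' := by
      by_contra hmm
      have hmq : G.Adj m q := by
        obtain ⟨w, h1, h2, h3⟩ := exists_adj_ne_ne x' p hm.ge
        have := Nm w h1
        grind
      have h1 : G.Adj m' p := by
        obtain ⟨w, h1, h2, h3⟩ := exists_adj_ne_ne y' q hm'.ge
        have := Nm' w h1
        have := fun h : G.Adj m' m => hmm h.symm
        grind
      have h2 : G.Adj m' q := by
        obtain ⟨w, h1, h2, h3⟩ := exists_adj_ne_ne y' p hm'.ge
        have := Nm' w h1
        have := fun h : G.Adj m' m => hmm h.symm
        grind
      exact (c4 hmp h1.symm h2 hmq.symm).elim dm hpq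
    have hmq : ¬ G.Adj m q := fun h => by
      have := eq_of_adj_of_deg_le_three hm.le hxm.symm hmm hmp e7.symm hp.2.2.2.1.symm
        hp.2.2.2.2.2.2.2.symm h
      grind
    have Np : ∀ w, G.Adj p w → w = z' ∨ w = m ∨ w = m' ∨ w = q := by
      intro w hw
      have hw' := hw.symm
      have := hO w
      have := hw.ne
      by_contra hcon
      clear c4 hedge hd
      grind
    have Nq : ∀ w, G.Adj q w → w = z' ∨ w = m ∨ w = m' ∨ w = p := by
      intro w hw
      have hw' := hw.symm
      have := hO w
      have := hw.ne
      by_contra hcon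
      clear c4 hedge hd
      grind
    by_cases hmp' : G.Adj m' p
    · have hmq' : ¬ G.Adj m' q := fun h => by
        have := eq_of_adj_of_deg_le_three hm'.le hym.symm hmm.symm hmp' e3.symm
          hp.2.2.2.2.1.symm hp.2.2.2.2.2.2.1.symm h
        grind
      have hqm : ¬ G.Adj q m := fun h => hmq h.symm
      have hqm' : ¬ G.Adj q m' := fun h => hmq' h.symm
      have hq2 : deg G q ≤ 2 := deg_le_two_of_forall (a := z') (b := p) fun w hw => by
        have := Nq w hw
        grind
      have hq2' : 2 ≤ deg G q := by have := hd q; omega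
      have hqz : G.Adj q z' := by
        obtain ⟨w, h1, h2⟩ := exists_adj_ne p hq2'
        have := Nq w h1
        grind
      have hqp : G.Adj q p := by
        obtain ⟨w, h1, h2⟩ := exists_adj_ne z' hq2'
        have := Nq w h1
        grind
      have hpz : ¬ G.Adj p z' := fun h => by
        have := eq_of_adj_of_deg_le_three (by have := hd p; omega) hmp.symm hmp'.symm hqp.symm dm
          hq.2.2.2.2.2.2.1.symm hq.2.2.2.2.2.2.2.symm h
        grind
      have hz2 : deg G z' ≤ 2 := deg_le_two_of_forall (a := z) (b := q) fun w hw => by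
        have hw' := hw.symm
        have := hO w
        have := hw.ne
        by_contra hcon
        clear c4 hedge hd
        grind
      have := hedge hqz
      omega
    · have hmq' : G.Adj m' q := by
        obtain ⟨w, h1, h2, h3⟩ := exists_adj_ne_ne y' m hm'.ge
        have := Nm' w h1
        grind
      have hpq' : ¬ G.Adj p q := fun h =>
        (c4 hmp h hmq'.symm hmm.symm).elim hq.2.2.2.2.2.2.1.symm hp.2.2.2.2.2.2.2
      have hpm : ¬ G.Adj p m' := fun h => hmp' h.symm
      have hqm : ¬ G.Adj q m := fun h => hmq h.symm
      have hqp : ¬ G.Adj q p := fun h => hpq' h.symm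
      have hpz : G.Adj p z' := by
        obtain ⟨w, h1, h2⟩ := exists_adj_ne m (by have := hd p; omega : 2 ≤ deg G p)
        have := Np w h1
        grind
      have hqz : G.Adj q z' := by
        obtain ⟨w, h1, h2⟩ := exists_adj_ne m' (by have := hd q; omega : 2 ≤ deg G q)
        have := Nq w h1
        grind
      exact hG.not_isCycle_five hpz.symm hmp.symm hmm hmq' hqz (fun h => a4 h.symm) hpm hmq b4 hqp
  obtain ⟨w, h1, h2, h3⟩ := exists_adj_ne_ne x' m' hm.ge
  have := hO' w
  have := h1.ne
  rcases (by grind : w = p ∨ w = q) with rfl | rfl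
  · exact main w q hpq hO' h1
  · exact main w p hpq.symm (fun v => (hO' v).trans or_comm) h1

/-- Summing over the neighbourhood of `v` together with its image under the exchange of partners. -/
theorem two_mul_sum_nbr {v : V} {π : V → V} (hπ : ∀ u ∈ nbr G v, π u ∈ nbr G v ∧ π (π u) = u)
    (f : V → ℕ) : ∑ u ∈ nbr G v, (f u + f (π u)) = 2 * ∑ u ∈ nbr G v, f u := by
  rw [Finset.sum_add_distrib, two_mul]
  congr 1
  refine Finset.sum_nbij' π π (fun u hu => (hπ u hu).1) (fun u hu => (hπ u hu).1)
    (fun u hu => (hπ u hu).2) (fun u hu => (hπ u hu).2) fun u _ => rfl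

theorem codeg_pos_of_triangle {x y z : V} (hxz : G.Adj x z) (hyz : G.Adj y z) :
    0 < codeg G x y := Finset.card_pos.2 ⟨z, by simp [hxz, hyz]⟩

theorem forces_ten_six : Forces 10 6 := by
  intro V _ G hG hV
  by_contra hno
  have hlow : ∀ v, 2 ≤ deg G v := fun v => by
    have := card_lt_deg_add hG hno forces_eight_five v
    omega
  have hedge : ∀ {u v}, G.Adj u v → 5 + codeg G u v ≤ deg G u + deg G v := fun huv => by
    have := card_lt_deg_add_deg hG hno forces_six_four huv
    omega
  have hsum : ∀ v, ∑ u ∈ nbr G v, (children G v u).card ≤ 4 := fun v => by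
    have := sum_children_lt hG hno v
    omega
  have hch : ∀ {v u}, G.Adj v u → deg G u = 1 + codeg G v u + (children G v u).card := fun h =>
    IsSquareFreePerfect.deg_eq h
  have hc : ∀ {v u}, G.Adj v u → codeg G v u ≤ 1 := fun h => hG.codeg_le_one h.ne
  have hch2 : ∀ {v u}, deg G v = 2 → G.Adj v u → 2 ≤ (children G v u).card := fun h2 huv => by
    have := hedge huv
    have := hch huv
    omega
  have hsum2 : ∀ {v}, deg G v = 2 → 4 ≤ ∑ u ∈ nbr G v, (children G v u).card := fun {v} h2 => by
    have := mul_le_sum (f := fun u => (children G v u).card) (m := 2) (A := nbr G v)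
      fun u hu => hch2 h2 (mem_nbr.1 hu)
    rw [deg] at h2
    omega
  have hdeg2 : ∀ {v u}, deg G v = 2 → G.Adj v u → deg G u = 3 + codeg G v u :=
    fun {v u} h2 huv => by
      have := add_mul_le_sum (f := fun u => (children G v u).card) (m := 2) (mem_nbr.2 huv)
        fun x hx _ => hch2 h2 (mem_nbr.1 hx)
      have := hsum v
      have := hch huv
      have := hch2 h2 huv
      rw [deg] at h2
      omega
  have hle4 : ∀ v, deg G v ≤ 4 := by
    intro v
    by_contra hv
    have := mul_le_sum (f := fun u => (children G v u).card) (m := 1) (A := nbr G v)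
      fun u hu => by
        have hu := mem_nbr.1 hu
        have := hch hu
        have := hc hu
        have := hc hu.symm
        have := hlow u
        have : deg G u ≠ 2 := fun h2 => by
          have := hdeg2 h2 hu.symm
          omega
        omega
    have := hsum v
    rw [deg] at hv
    omega
  -- A vertex of degree four lies in two triangles, and the degrees in each of them add up to ten.
  have hfour : ∀ {v}, deg G v = 4 → 4 ≤ ∑ u ∈ nbr G v, (children G v u).card ∧
      ∀ u, G.Adj v u → ∃ u', G.Adj v u' ∧ G.Adj u u' ∧ deg G u + deg G u' = 6 := by
    intro v hv
    obtain ⟨π, hπ⟩ := hG.exists_partner v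
    have hsπ := two_mul_sum_nbr (fun u hu => ⟨(hπ u hu).1, (hπ u hu).2.1⟩)
      (fun u => (children G v u).card)
    have hv' : (nbr G v).card = 4 := hv
    have hpair : ∀ u ∈ nbr G v, 2 ≤ (children G v u).card + (children G v (π u)).card ∧
        (codeg G v u = 0 → 4 ≤ (children G v u).card + (children G v (π u)).card) := by
      intro u hu
      obtain ⟨h1, h2, h3, h4⟩ := hπ u hu
      have hu := mem_nbr.1 hu
      have hcu := hch hu
      by_cases h0 : codeg G v u = 0
      · rw [h3 h0]
        have : deg G u ≠ 2 := fun h2 => by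
          have := hdeg2 h2 hu.symm
          rw [codeg_comm] at this
          omega
        have := hlow u
        omega
      · have h5 := h4 h0
        have h1 := mem_nbr.1 h1
        have := hch h1
        have := hc h1
        have := hc hu
        have := hedge h5
        have := codeg_pos_of_triangle hu.symm h1.symm
        omega
    have hs4 := hsum v
    refine ⟨?_, fun u hu => ?_⟩
    · have := mul_le_sum fun u hu => (hpair u hu).1
      omega
    · have hm := mem_nbr.2 hu
      have h1 := add_mul_le_sum hm fun x hx _ => (hpair x hx).1
      obtain ⟨a, b⟩ := hpair u hm
      have h0 : codeg G v u ≠ 0 := fun h0 => by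
        have := b h0
        omega
      obtain ⟨h1, h2, h3, h4⟩ := hπ u hm
      have h1 := mem_nbr.1 h1
      refine ⟨π u, h1, h4 h0, ?_⟩
      have := hch hu
      have := hch h1
      have := hc hu
      have := hc h1
      have := codeg_pos_of_triangle h1 (h4 h0)
      have := codeg_pos_of_triangle hu (h4 h0).symm
      omega
  have hd : ∀ v, deg G v = 2 ∨ deg G v = 3 := by
    intro v
    by_contra hcon
    have hv : deg G v = 4 := by have := hlow v; have := hle4 v; omega
    obtain ⟨u, hu⟩ := exists_adj_of_deg_pos (by omega : 0 < deg G v)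
    obtain ⟨u', hu', huu', hs⟩ := (hfour hv).2 u hu
    have hbig : ∀ {a b}, G.Adj v a → G.Adj v b → G.Adj a b → 4 ≤ (secondNbr G a).card := by
      intro a b ha hb hab
      rw [hG.card_secondNbr]
      rcases (by have := hlow a; have := hle4 a; omega :
        deg G a = 2 ∨ deg G a = 3 ∨ deg G a = 4) with h | h | h
      · exact hsum2 h
      · have h3 : (nbr G a).card = 3 := h
        have h1 : ∀ x ∈ nbr G a, 1 ≤ (children G a x).card := fun x hx => by
          have hx := mem_nbr.1 hx
          have := hedge hx
          have := hch hx
          omega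
        have := add_mul_le_sum (mem_nbr.2 ha.symm) fun x hx _ => h1 x hx
        have := hch ha.symm
        have := hc ha.symm
        omega
      · exact (hfour h).1
    have h1 := hbig hu hu' huu'
    have h2 := hbig hu' hu huu'.symm
    have h3 : 4 ≤ (secondNbr G v).card := by rw [hG.card_secondNbr]; exact (hfour hv).1
    have := hG.card_secondNbr_triangle hu huu' hu'
    omega
  have hind : ∀ {a b}, deg G a = 2 → G.Adj a b → deg G b = 3 ∧ codeg G a b = 0 := by
    intro a b ha hab
    have := hdeg2 ha hab
    have := hd b
    omega
  by_cases htri : ∃ x y z, G.Adj x y ∧ G.Adj y z ∧ G.Adj x z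
  · obtain ⟨x, y, z, hxy, hyz, hxz⟩ := htri
    have hthree : ∀ {x y z}, G.Adj x y → G.Adj y z → G.Adj x z → deg G x = 3 := by
      intro x y z hxy hyz hxz
      refine (hd x).resolve_left fun h2 => ?_
      have := (hind h2 hxy).2
      have := codeg_pos_of_triangle hxz hyz
      omega
    have hx := hthree hxy hyz hxz
    have hy := hthree hyz hxz.symm hxy.symm
    have hz := hthree hxz.symm hxy hyz.symm
    have hatt : ∀ {x y z}, G.Adj x y → G.Adj y z → G.Adj x z → deg G x = 3 → deg G y = 3 →
        deg G z = 3 → ∃ x', G.Adj x x' ∧ x' ≠ y ∧ x' ≠ z ∧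
          (secondNbr G x).card + 1 = 2 + deg G x' := by
      intro x y z hxy hyz hxz hx hy hz
      obtain ⟨x', h1, h2, h3⟩ := exists_adj_ne_ne y z hx.ge
      refine ⟨x', h1, h2, h3, ?_⟩
      have hN : nbr G x = {y, z, x'} := by
        ext w
        rw [mem_nbr]
        constructor
        · intro hw
          simpa using eq_of_adj_of_deg_le_three hx.le hxy hxz h1 hyz.ne h2.symm h3.symm hw
        · intro hw
          simp only [mem_insert, mem_singleton] at hw
          rcases hw with rfl | rfl | rfl <;> assumption
      rw [hG.card_secondNbr, hN, Finset.sum_insert (by simp [hyz.ne, h2.symm]),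
        Finset.sum_insert (by simp [h3.symm]), Finset.sum_singleton]
      have e1 := hch hxy
      have e2 := hch hxz
      have e3 := hch h1
      have p1 := codeg_pos_of_triangle hxz hyz
      have p2 := codeg_pos_of_triangle hxy hyz.symm
      have p3 : codeg G x x' = 0 := by
        rw [codeg, Finset.card_eq_zero, Finset.eq_empty_iff_forall_notMem]
        intro w hw
        rw [mem_inter, hN] at hw
        simp only [mem_insert, mem_singleton, mem_nbr] at hw
        rcases hw with ⟨rfl | rfl | rfl, hw⟩
        · exact h3 (hG.eq_of_common hxy.ne h1 hw.symm hxz hyz)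
        · exact h2 (hG.eq_of_common hxz.ne h1 hw.symm hxy hyz.symm)
        · exact G.loopless.irrefl _ hw
      have := hc hxy
      have := hc hxz
      omega
    obtain ⟨x', hxx, x1, x2, x3⟩ := hatt hxy hyz hxz hx hy hz
    obtain ⟨y', hyy, y1, y2, y3⟩ := hatt hyz hxz.symm hxy.symm hy hz hx
    obtain ⟨z', hzz, z1, z2, z3⟩ := hatt hxz.symm hxy hyz.symm hz hx hy
    have ht := hG.card_secondNbr_triangle hxy hyz hxz
    have dx := hd x'
    have dy := hd y'
    have dz := hd z'
    rcases (by omega : (deg G x' = 2 ∧ deg G y' = 2) ∨ (deg G y' = 2 ∧ deg G z' = 2) ∨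
      (deg G z' = 2 ∧ deg G x' = 2)) with ⟨h1, h2⟩ | ⟨h1, h2⟩ | ⟨h1, h2⟩
    · exact not_two_attached_of_card_ten hG hV hd hedge hxy hyz hxz hx hy hz hxx hyy x1 x2 y2 y1
        h1 h2
    · exact not_two_attached_of_card_ten hG hV hd hedge hyz hxz.symm hxy.symm hy hz hx hyy hzz
        y1 y2 z2 z1 h1 h2
    · exact not_two_attached_of_card_ten hG hV hd hedge hxz.symm hxy hyz.symm hz hx hy hzz hxx
        z1 z2 x2 x1 h1 h2
  -- In the triangle-free case, count the edges between the vertices of degree two and those of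
  -- degree three.
  · have hc0 : ∀ {a b}, G.Adj a b → codeg G a b = 0 := by
      intro a b hab
      by_contra h
      obtain ⟨c, hc⟩ := Finset.card_pos.1 (Nat.pos_of_ne_zero h)
      rw [mem_inter, mem_nbr, mem_nbr] at hc
      exact htri ⟨a, b, c, hab, hc.2, hc.1⟩
    set D2 := univ.filter (fun v => deg G v = 2) with hD2
    set D3 := univ.filter (fun v => ¬ deg G v = 2) with hD3
    have hcard : D2.card + D3.card = 10 := by
      rw [← hV, ← Finset.card_univ]
      exact Finset.card_filter_add_card_filter_not _
    have hD2le : D2.card ≤ 5 := by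
      have : IsSparse G 1 D2 := by
        rw [isSparse_one_iff]
        intro v hv a ha b _ h1 _
        rw [hD2, mem_filter] at hv ha
        have := hind hv.2 h1
        omega
      have := card_lt_of_not_hasSparse hno this
      omega
    have hle : D3.card * 2 ≤ D2.card * 2 := by
      refine Finset.card_mul_le_card_mul G.Adj (fun v hv => ?_) (fun v hv => ?_)
      · rw [hD3, mem_filter] at hv
        have hv3 : deg G v = 3 := (hd v).resolve_left hv.2
        have hv3' : (nbr G v).card = 3 := hv3
        by_contra hlt
        have hlt' : ((nbr G v).filter (fun u => deg G u = 2)).card < 2 := by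
          refine lt_of_le_of_lt (Finset.card_le_card ?_) (not_le.1 hlt)
          intro u hu
          rw [mem_filter, mem_nbr] at hu
          rw [Finset.mem_bipartiteAbove, hD2, mem_filter]
          exact ⟨⟨mem_univ _, hu.2⟩, hu.1⟩
        have hs : ∑ u ∈ nbr G v, (if deg G u = 2 then 1 else 2) ≤
            ∑ u ∈ nbr G v, (children G v u).card := by
          refine Finset.sum_le_sum fun u hu => ?_
          have hu := mem_nbr.1 hu
          have := hch hu
          have := hc0 hu
          have := hd u
          split_ifs <;> omega
        rw [Finset.sum_ite, Finset.sum_const, Finset.sum_const] at hs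
        have := Finset.card_filter_add_card_filter_not (s := nbr G v) (fun u => deg G u = 2)
        have := hsum v
        simp only [smul_eq_mul] at hs
        omega
      · rw [hD2, mem_filter] at hv
        rw [← hv.2, deg]
        refine Finset.card_le_card fun u hu => ?_
        rw [Finset.mem_bipartiteBelow] at hu
        exact mem_nbr.2 hu.2.symm
    have hsd := G.sum_degrees_eq_twice_card_edges
    have hdd : ∀ v, G.degree v = if deg G v = 2 then 2 else 3 := by
      intro v
      have : G.degree v = deg G v := by
        rw [deg, ← SimpleGraph.card_neighborFinset_eq_degree]
        congr 1
        ext w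
        simp
      have := hd v
      split_ifs <;> omega
    rw [Finset.sum_congr rfl fun v _ => hdd v, Finset.sum_ite, Finset.sum_const,
      Finset.sum_const, ← hD2, ← hD3] at hsd
    simp only [smul_eq_mul] at hsd
    omega

/-! ### Graphs with fifteen and with twenty-two vertices -/

theorem forces_fifteen_eight : Forces 15 8 := by
  intro V _ G hG hV
  by_contra hno
  have hedge : ∀ {u v}, G.Adj u v → 6 + codeg G u v ≤ deg G u + deg G v := fun huv => by
    have := card_lt_deg_add_deg hG hno forces_ten_six huv
    omega
  have hcommon : ∀ {a b v}, a ≠ b → G.Adj v a → G.Adj v b → 5 ≤ deg G a + deg G b :=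
    fun hab ha hb => by
      have := card_lt_of_common hG hno forces_ten_six hab ha hb
      omega
  have hsum : ∀ v, ∑ u ∈ nbr G v, (children G v u).card ≤ 6 := fun v => by
    have := sum_children_lt hG hno v
    omega
  have hch : ∀ {v u}, G.Adj v u → deg G u = 1 + codeg G v u + (children G v u).card := fun h =>
    IsSquareFreePerfect.deg_eq h
  have hc : ∀ {v u}, G.Adj v u → codeg G v u ≤ 1 := fun h => hG.codeg_le_one h.ne
  have hch' : ∀ {v u}, G.Adj v u → 5 ≤ deg G v + (children G v u).card := fun huv => by
    have := hedge huv
    have := hch huv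
    omega
  have hdeg2 : ∀ {v u}, deg G v = 2 → G.Adj v u → deg G u = 4 + codeg G v u :=
    fun {v u} h2 huv => by
      have := add_mul_le_sum (f := fun u => (children G v u).card) (m := 3) (mem_nbr.2 huv)
        fun x hx _ => by have := hch' (mem_nbr.1 hx); omega
      have := hsum v
      have := hch huv
      have := hch' huv
      have : (nbr G v).card = 2 := h2
      omega
  have hdeg3 : ∀ {v u}, deg G v = 3 → G.Adj v u → deg G u = 3 + codeg G v u :=
    fun {v u} h3 huv => by
      have := add_mul_le_sum (f := fun u => (children G v u).card) (m := 2) (mem_nbr.2 huv)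
        fun x hx _ => by have := hch' (mem_nbr.1 hx); omega
      have := hsum v
      have := hch huv
      have := hch' huv
      have : (nbr G v).card = 3 := h3
      omega
  -- The neighbours of a vertex of degree at least five have degree at least four, with at most
  -- one exception, and so have at least two children each.
  have hle4 : ∀ v, deg G v ≤ 4 := by
    intro v
    by_contra hv
    have hbig : ∀ u ∈ nbr G v, 3 ≤ deg G u → 2 ≤ (children G v u).card := fun u hu h => by
      have hu := mem_nbr.1 hu
      have := hch hu
      have := hc hu
      have := hc hu.symm
      have : deg G u ≠ 3 := fun h3 => by
        have := hdeg3 h3 hu.symm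
        omega
      omega
    have hs := hsum v
    rw [deg] at hv
    by_cases hex : ∃ a ∈ nbr G v, deg G a < 3
    · obtain ⟨a, ha, ha3⟩ := hex
      have := add_mul_le_sum (f := fun u => (children G v u).card) (m := 2) ha
        fun x hx hxa => hbig x hx (by
          have := hcommon hxa (mem_nbr.1 hx) (mem_nbr.1 ha)
          omega)
      omega
    · push Not at hex
      have := mul_le_sum (f := fun u => (children G v u).card) (m := 2) (A := nbr G v)
        fun x hx => hbig x hx (hex x hx)
      omega
  have hind : ∀ {a b}, deg G a = 2 → G.Adj a b → deg G b = 4 ∧ codeg G a b = 0 := by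
    intro a b ha hab
    have := hdeg2 ha hab
    have := hle4 b
    omega
  have hge2 : ∀ {u v}, G.Adj u v → 2 ≤ deg G v := fun {u _} huv => by
    have := hedge huv
    have := hle4 u
    omega
  -- Partners in the neighbourhood of a vertex of degree four have degree sum at least seven, hence
  -- three or more children in all.
  have hpair : ∀ {v u u'}, deg G v = 4 → G.Adj v u → G.Adj v u' → G.Adj u u' →
      deg G u + deg G u' = 4 + ((children G v u).card + (children G v u').card) ∧
        7 ≤ deg G u + deg G u' := by
    intro v u u' hv hu hu' h
    have := hch hu
    have := hch hu'
    have := hc hu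
    have := hc hu'
    have := hedge h
    have := codeg_pos_of_triangle hu.symm hu'.symm
    have := codeg_pos_of_triangle hu' h
    have := codeg_pos_of_triangle hu h.symm
    omega
  -- A neighbour of a vertex of degree four that lies in no triangle with it has degree two or four,
  -- since the neighbours of a vertex of degree three outside its triangles have degree three.
  have hsingle : ∀ {v u}, deg G v = 4 → G.Adj v u → codeg G v u = 0 → deg G u ≠ 2 →
      (children G v u).card = 3 := by
    intro v u hv hu h0 h2
    have := hch hu
    have := hge2 hu
    have := hle4 u
    have : deg G u ≠ 3 := fun h3 => by
      have := hdeg3 h3 hu.symm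
      rw [codeg_comm] at this
      omega
    omega
  have htwo : ∀ {v b}, deg G b = 2 → G.Adj v b → ∃ b', b' ≠ b ∧ G.Adj v b' ∧ deg G b' = 2 := by
    intro v b hb hvb
    by_contra hcon
    push Not at hcon
    obtain ⟨hv, h0⟩ := hind hb hvb.symm
    rw [codeg_comm] at h0
    have hv' : (nbr G v).card = 4 := hv
    obtain ⟨π, hπ⟩ := hG.exists_partner v
    have hsπ := two_mul_sum_nbr (fun u hu => ⟨(hπ u hu).1, (hπ u hu).2.1⟩)
      (fun u => (children G v u).card)
    have hbm := mem_nbr.2 hvb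
    have h3 : ∀ u ∈ nbr G v, u ≠ b → 3 ≤ (children G v u).card + (children G v (π u)).card ∧
        (codeg G v u = 0 → 6 ≤ (children G v u).card + (children G v (π u)).card) := by
      intro u hu hub
      obtain ⟨h1, h2, h3, h4⟩ := hπ u hu
      have hu := mem_nbr.1 hu
      by_cases h0 : codeg G v u = 0
      · rw [h3 h0]
        have := hsingle hv hu h0 (hcon u hub hu)
        omega
      · have := hpair hv hu (mem_nbr.1 h1) (h4 h0)
        omega
    have hb1 : (children G v b).card + (children G v (π b)).card = 2 := by
      rw [(hπ b hbm).2.2.1 h0]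
      have := hch hvb
      omega
    have hs := hsum v
    -- Besides `b`, one of the three neighbours of `v` is unmatched, for parity reasons.
    obtain ⟨u, hu, hub, hu0⟩ : ∃ u ∈ nbr G v, u ≠ b ∧ codeg G v u = 0 := by
      by_contra hall
      push Not at hall
      have he := hG.even_card_codeg v
      have : (nbr G v).filter (fun u => codeg G v u ≠ 0) = (nbr G v).erase b := by
        ext u
        rw [mem_filter, mem_erase]
        constructor
        · rintro ⟨h1, h2⟩
          exact ⟨by rintro rfl; exact h2 h0, h1⟩
        · rintro ⟨h1, h2⟩
          exact ⟨h2, hall u h2 h1⟩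
      rw [this, Finset.card_erase_of_mem hbm, hv'] at he
      exact absurd he (by decide)
    have h1 := Finset.add_sum_erase (nbr G v)
      (fun u => (children G v u).card + (children G v (π u)).card) hbm
    have h2 := add_mul_le_sum (A := (nbr G v).erase b)
      (f := fun u => (children G v u).card + (children G v (π u)).card) (m := 3)
      (mem_erase.2 ⟨hub, hu⟩) fun x hx _ => (h3 x (mem_erase.1 hx).2 (mem_erase.1 hx).1).1
    rw [Finset.card_erase_of_mem hbm] at h2
    have := (h3 u hu hub).2 hu0
    omega
  -- The vertices of degree two form a sparse set with a closed neighbourhood that is too small.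
  have hno2 : ∀ v, deg G v ≠ 2 := by
    intro v hv
    set T := univ.filter (fun v => deg G v = 2) with hT
    have hTs : IsSparse G 1 T := by
      rw [isSparse_one_iff]
      intro v hv a ha b _ h1 _
      rw [hT, mem_filter] at hv ha
      have := hind hv.2 h1
      omega
    have hle : (T.biUnion (nbr G)).card * 2 ≤ T.card * 2 := by
      refine Finset.card_mul_le_card_mul G.Adj (fun v hv => ?_) (fun v hv => ?_)
      · rw [mem_biUnion] at hv
        obtain ⟨b, hb, hbv⟩ := hv
        have hvb := (mem_nbr.1 hbv).symm
        have hb2 : deg G b = 2 := by simpa [hT] using hb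
        obtain ⟨b', hne, hvb', hb2'⟩ := htwo hb2 hvb
        rw [← Finset.card_pair hne]
        refine Finset.card_le_card fun x hx => ?_
        rw [Finset.mem_bipartiteAbove, hT, mem_filter]
        rw [mem_insert, mem_singleton] at hx
        rcases hx with rfl | rfl
        · exact ⟨⟨mem_univ _, hb2'⟩, hvb'⟩
        · exact ⟨⟨mem_univ _, hb2⟩, hvb⟩
      · rw [hT, mem_filter] at hv
        rw [← hv.2, deg]
        refine Finset.card_le_card fun u hu => ?_
        rw [Finset.mem_bipartiteBelow] at hu
        exact mem_nbr.2 hu.2.symm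
    have hcl : (closedNbr G T).card ≤ 2 * T.card := by
      have := Finset.card_union_le T (T.biUnion (nbr G))
      rw [closedNbr]
      omega
    have h2 : 2 ≤ T.card := by
      obtain ⟨u, hu⟩ := exists_adj_of_deg_pos (by omega : 0 < deg G v)
      obtain ⟨b, hne, hub, hb⟩ := htwo hv hu.symm
      rw [← Finset.card_pair hne]
      refine Finset.card_le_card fun x hx => ?_
      rw [mem_insert, mem_singleton] at hx
      rcases hx with rfl | rfl
      · simpa [hT] using hb
      · simpa [hT] using hv
    have h8 := card_lt_of_not_hasSparse hno hTs
    have hF : ∀ {n k}, Forces n k → T.card + k = 8 → 15 < (closedNbr G T).card + n := by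
      intro n k hF hk
      rw [← hV]
      exact card_lt_closedNbr hG hno hF hTs hk
    rcases (by omega : T.card = 2 ∨ T.card = 3 ∨ T.card = 4 ∨ T.card = 5 ∨ T.card = 6 ∨
      T.card = 7) with h | h | h | h | h | h
    · have := hF forces_ten_six (by omega); omega
    · have := hF forces_eight_five (by omega); omega
    · have := hF forces_six_four (by omega); omega
    · have := hF forces_four_three (by omega); omega
    · have := hF (Forces.of_le_two le_rfl) (by omega); omega
    · have := hF (Forces.of_le_two one_le_two) (by omega); omega
  -- So a vertex of degree four lies in two triangles, both with degrees three, four and four.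
  have hfour : ∀ {v}, deg G v = 4 → 6 ≤ ∑ u ∈ nbr G v, (children G v u).card ∧
      ∀ u u', G.Adj v u → G.Adj v u' → G.Adj u u' → deg G u + deg G u' = 7 := by
    intro v hv
    have hv' : (nbr G v).card = 4 := hv
    obtain ⟨π, hπ⟩ := hG.exists_partner v
    have hsπ := two_mul_sum_nbr (fun u hu => ⟨(hπ u hu).1, (hπ u hu).2.1⟩)
      (fun u => (children G v u).card)
    have h3 : ∀ u ∈ nbr G v, 3 ≤ (children G v u).card + (children G v (π u)).card := by
      intro u hu
      obtain ⟨h1, h2, h3, h4⟩ := hπ u hu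
      have hu := mem_nbr.1 hu
      by_cases h0 : codeg G v u = 0
      · rw [h3 h0]
        have := hsingle hv hu h0 (hno2 u)
        omega
      · have := hpair hv hu (mem_nbr.1 h1) (h4 h0)
        omega
    have hs := hsum v
    refine ⟨?_, fun u u' hu hu' h => ?_⟩
    · have := mul_le_sum h3
      omega
    · have hum := mem_nbr.2 hu
      have h0 : codeg G v u ≠ 0 := (codeg_pos_of_triangle hu' h).ne'
      have hπu : π u = u' := by
        have h1 := (hπ u hum).1
        exact hG.eq_of_common hu.ne (mem_nbr.1 h1) ((hπ u hum).2.2.2 h0) hu' h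
      have h1 := add_mul_le_sum hum fun x hx _ => h3 x hx
      have := hpair hv hu hu' h
      rw [hπu] at h1
      omega
  have hthree : ∀ {v}, deg G v = 3 → 6 ≤ ∑ u ∈ nbr G v, (children G v u).card := by
    intro v hv
    have := mul_le_sum (f := fun u => (children G v u).card) (m := 2) (A := nbr G v)
      fun x hx => by have := hch' (mem_nbr.1 hx); omega
    rw [deg] at hv
    omega
  by_cases htri : ∃ x y z, G.Adj x y ∧ G.Adj y z ∧ G.Adj x z
  · obtain ⟨x, y, z, hxy, hyz, hxz⟩ := htri
    have hd : ∀ {u v}, G.Adj u v → deg G v = 3 ∨ deg G v = 4 := fun {u v} h => by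
      have := hge2 h
      have := hle4 v
      have := hno2 v
      omega
    have h6 : ∀ {u v}, G.Adj u v → 6 ≤ (secondNbr G v).card := fun h => by
      rw [hG.card_secondNbr]
      exact (hd h).elim hthree fun h4 => (hfour h4).1
    have hx := h6 hxy.symm
    have hy := h6 hxy
    have hz := h6 hyz
    have ht := hG.card_secondNbr_triangle hxy hyz hxz
    have dx := hd hxy.symm
    have dy := hd hxy
    have dz := hd hyz
    have sx := fun h => (hfour (v := x) h).2 y z hxy hxz hyz
    have sy := fun h => (hfour (v := y) h).2 x z hxy.symm hyz hxz
    omega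
  · obtain ⟨f, hf⟩ := hG.bipartite_of_triangleFree Set.univ
      fun a _ b _ c _ hab hbc hac => htri ⟨a, b, c, hab, hbc, hac⟩
    have hs : ∀ i, (univ.filter (fun v => f v = i)).card < 8 := fun i => by
      refine card_lt_of_not_hasSparse hno ?_
      rw [isSparse_one_iff]
      intro v hv a ha b _ h1 _
      rw [mem_filter] at hv ha
      exact absurd (hv.2.trans ha.2.symm) (hf v trivial a trivial h1)
    have h1 := hs true
    have h2 := hs false
    have h3 := Finset.card_filter_add_card_filter_not (s := univ) (fun v => f v = true)
    simp only [Bool.not_eq_true] at h3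
    rw [Finset.card_univ, hV] at h3
    omega

theorem forces_twentytwo_ten : Forces 22 10 := by
  intro V _ G hG hV
  by_contra hno
  have hedge : ∀ {u v}, G.Adj u v → 8 + codeg G u v ≤ deg G u + deg G v := fun huv => by
    have := card_lt_deg_add_deg hG hno forces_fifteen_eight huv
    omega
  have hsum : ∀ v, ∑ u ∈ nbr G v, (children G v u).card ≤ 8 := fun v => by
    have := sum_children_lt hG hno v
    omega
  have hch : ∀ {v u}, G.Adj v u → deg G u = 1 + codeg G v u + (children G v u).card := fun h =>
    IsSquareFreePerfect.deg_eq h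
  -- A vertex of degree `d` with `2 ≤ d ≤ 5` has at least `d * (7 - d) ≥ 10` vertices at distance
  -- two.
  have hdeg : ∀ {u v}, G.Adj u v → deg G v = 1 ∨ 6 ≤ deg G v := by
    intro u v huv
    have h0 := deg_pos_of_adj huv
    by_contra hcon
    have h1 := mul_le_sum (f := fun u => (children G v u).card) (m := 7 - deg G v) (A := nbr G v)
      fun x hx => by
        have := hedge (mem_nbr.1 hx)
        have := hch (mem_nbr.1 hx)
        omega
    have h2 := hsum v
    change deg G v * (7 - deg G v) ≤ _ at h1
    rcases (by omega : deg G v = 2 ∨ deg G v = 3 ∨ deg G v = 4 ∨ deg G v = 5) with h | h | h | h <;>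
      rw [h] at h1 <;> omega
  have hsix : ∀ v, ¬ 6 ≤ deg G v := by
    intro v hv
    have hbig : ∀ u ∈ nbr G v, deg G u ≠ 1 → 4 ≤ (children G v u).card := fun u hu h => by
      have hu := mem_nbr.1 hu
      have := hch hu
      have := hG.codeg_le_one hu.ne
      have := hdeg hu
      omega
    have hs := hsum v
    rw [deg] at hv
    by_cases hex : ∃ a ∈ nbr G v, deg G a = 1
    · obtain ⟨a, ha, ha1⟩ := hex
      have := add_mul_le_sum (f := fun u => (children G v u).card) (m := 4) ha
        fun x hx hxa => hbig x hx fun h => by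
          have := card_lt_of_common hG hno forces_fifteen_eight hxa (mem_nbr.1 hx) (mem_nbr.1 ha)
          omega
      omega
    · push Not at hex
      have := mul_le_sum (f := fun u => (children G v u).card) (m := 4) (A := nbr G v)
        fun x hx => hbig x hx (hex x hx)
      omega
  have hnone : ∀ u v, ¬ G.Adj u v := fun u v huv => by
    have := hedge huv
    have := hdeg huv
    have := hdeg huv.symm
    have := hsix u
    have := hsix v
    omega
  refine hno ⟨univ, by rw [Finset.card_univ, hV]; norm_num, ?_⟩
  rw [isSparse_one_iff]
  intro v _ a _ b _ h1 _
  exact absurd h1 (hnone v a)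

/-! ### Perfect graphs without a dense set of four vertices -/

theorem isSquareFreePerfect_of_isPerfect (hG : IsPerfect G)
    (hD : ¬ ∃ D : Finset V, D.card = 4 ∧ IsDense G 1 D) : IsSquareFreePerfect G where
  eq_of_common a b c d hab hac hbc had hbd := by
    by_contra hcd
    refine hD ⟨{a, b, c, d}, ?_, ?_⟩
    · rw [Finset.card_insert_of_notMem (by simp [hab, hac.ne, had.ne]),
        Finset.card_insert_of_notMem (by simp [hbc.ne, hbd.ne]), Finset.card_pair hcd]
    · rw [IsDense, isSparse_one_iff]
      have := hac.symm; have := hbc.symm; have := had.symm; have := hbd.symm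
      intro v hv x hx y hy h1 h2
      rw [SimpleGraph.compl_adj] at h1 h2
      simp only [mem_insert, mem_singleton] at hv hx hy
      rcases hv with rfl | rfl | rfl | rfl <;> rcases hx with rfl | rfl | rfl | rfl <;>
        first
        | exact absurd rfl h1.1
        | exact absurd ‹_› h1.2
        | (rcases hy with rfl | rfl | rfl | rfl <;>
            first
            | rfl
            | exact absurd rfl h2.1
            | exact absurd ‹_› h2.2)
  bipartite_of_triangleFree s hs := by
    have h2 : (G.induce s).cliqueNum ≤ 2 := by
      by_contra hlt
      obtain ⟨t, ht⟩ := (G.induce s).exists_isNClique_cliqueNum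
      obtain ⟨a, ha, b, hb, c, hc, hab, hac, hbc⟩ :=
        Finset.two_lt_card.1 (by rw [ht.card_eq]; omega : 2 < t.card)
      exact hs a a.2 b b.2 c c.2 (ht.isClique ha hb hab) (ht.isClique hb hc hbc)
        (ht.isClique ha hc hac)
    have hcol : (G.induce s).Colorable 2 := by
      rw [← SimpleGraph.chromaticNumber_le_iff_colorable, hG s]
      exact_mod_cast h2
    obtain ⟨C⟩ := hcol
    refine ⟨fun v => if h : v ∈ s then decide (C ⟨v, h⟩ = 0) else false, ?_⟩
    intro a ha b hb hab
    have hne : C ⟨a, ha⟩ ≠ C ⟨b, hb⟩ := C.valid hab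
    simp only [ha, hb, dif_pos, ne_eq, decide_eq_decide]
    omega

theorem mem_ramseyOrders_twentytwo : 22 ∈ ramseyOrders perfectGraphs 1 4 10 := by
  intro G hG
  by_contra hcon
  rw [not_or] at hcon
  obtain ⟨S, hS, hSs⟩ :=
    forces_twentytwo_ten _ G (isSquareFreePerfect_of_isPerfect hG hcon.1) (by simp)
  obtain ⟨T, hT, hTc⟩ := Finset.exists_subset_card_eq hS
  exact hcon.2 ⟨T, hTc, hSs.subset hT⟩

end UpperBound

section LowerBound

open Finset

/-! ### Two-colouring the union of two matchings -/

/-- The orbits of `P * Q` are exchanged in pairs by `P`, and an orbit mapped to itself would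
produce a fixed point of `P` or of `Q`. Colouring the two orbits of each pair differently gives the
required colouring. -/
theorem exists_two_coloring_of_involutions {β : Type} (P Q : Equiv.Perm β) (hP : P * P = 1)
    (hQ : Q * Q = 1) (hP' : ∀ x, P x ≠ x) (hQ' : ∀ x, Q x ≠ x) :
    ∃ c : β → Bool, ∀ x, c x ≠ c (P x) ∧ c x ≠ c (Q x) := by
  classical
  set σ := P * Q with hσ
  have hPinv : P⁻¹ = P := inv_eq_of_mul_eq_one_left hP
  have hQinv : Q⁻¹ = Q := inv_eq_of_mul_eq_one_left hQ
  have hconj : ∀ (j : ℤ) (x : β), P ((σ ^ j) x) = (σ ^ (-j)) (P x) := by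
    intro j x
    have h1 : P * σ * P⁻¹ = σ⁻¹ := by
      rw [hσ, mul_inv_rev, hPinv, hQinv, ← mul_assoc, hP, one_mul]
    have h2 : P * σ ^ j * P⁻¹ = σ ^ (-j) := by
      rw [← conj_zpow, h1, inv_zpow']
    rw [← h2]
    simp
  have hQσ : ∀ x, Q x = P (σ x) := fun x => by
    have : Q = P * σ := by rw [hσ, ← mul_assoc, hP, one_mul]
    rw [this]
    rfl
  have hPP : ∀ x, P (P x) = x := fun x => by
    rw [← Equiv.Perm.mul_apply, hP, Equiv.Perm.one_apply]
  have hne : ∀ x, ¬ σ.SameCycle x (P x) := by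
    rintro x ⟨k, hk⟩
    obtain ⟨j, rfl | rfl⟩ := Int.even_or_odd' k
    · refine hP' ((σ ^ j) x) ?_
      rw [hconj, ← hk, ← Equiv.Perm.mul_apply, ← zpow_add]
      congr 2
      ring
    · refine hQ' ((σ ^ j) x) ?_
      have h1 : σ ((σ ^ j) x) = (σ ^ (1 + j)) x := by
        rw [zpow_one_add]
        rfl
      rw [hQσ, h1, hconj, ← hk, ← Equiv.Perm.mul_apply, ← zpow_add]
      congr 2
      ring
  let q : β → Quotient (Equiv.Perm.SameCycle.setoid σ) := fun x => ⟦x⟧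
  have hq : ∀ x y, q x = q y ↔ σ.SameCycle x y := fun x y => Quotient.eq
  have hQ1 : ∀ x, q (Q x) = q (P x) := fun x => by
    rw [hq, hQσ]
    have := hconj 1 x
    rw [zpow_one] at this
    rw [this]
    exact (Equiv.Perm.sameCycle_zpow_left).2 (Equiv.Perm.SameCycle.refl _ _)
  have hQ2 : ∀ x, q (P (Q x)) = q x := fun x => by
    rw [hq]
    exact ⟨-1, by simp [hσ]⟩
  have key : ∀ x, decide (WellOrderingRel (q x) (q (P x))) ≠
      decide (WellOrderingRel (q (P x)) (q x)) := by
    intro x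
    rw [ne_eq, decide_eq_decide]
    have h1 : q x ≠ q (P x) := fun h => hne x ((hq _ _).1 h)
    rcases trichotomous_of WellOrderingRel (q x) (q (P x)) with h | h | h
    · exact fun h' => asymm h (h'.1 h)
    · exact absurd h h1
    · exact fun h' => asymm h (h'.2 h)
  refine ⟨fun x => decide (WellOrderingRel (q x) (q (P x))), fun x => ⟨?_, ?_⟩⟩
  · simp only [hPP]
    exact key x
  · simp only [hQ1, hQ2]
    exact key x

/-- A matching on `α` extends to a fixed-point-free involution of `α × Bool`, which exchanges the
two copies of each unmatched vertex. -/
theorem exists_involution_of_matching {α : Type} {p : α → α → Prop} (hs : ∀ a b, p a b → p b a)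
    (hi : ∀ a, ¬ p a a) (hm : ∀ a b c, p a b → p a c → b = c) :
    ∃ P : Equiv.Perm (α × Bool), P * P = 1 ∧ (∀ x, P x ≠ x) ∧
      ∀ a b i, p a b → P (a, i) = (b, i) := by
  classical
  let g : α × Bool → α × Bool := fun x =>
    if h : ∃ b, p x.1 b then (h.choose, x.2) else (x.1, !x.2)
  have hg : ∀ a b i, p a b → g (a, i) = (b, i) := by
    intro a b i hab
    have h : ∃ b, p a b := ⟨b, hab⟩
    have : g (a, i) = (h.choose, i) := dif_pos h
    rw [this, hm a _ b h.choose_spec hab]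
  have hg' : ∀ a i, (¬ ∃ b, p a b) → g (a, i) = (a, !i) := fun a i h => dif_neg h
  have hinv : Function.Involutive g := by
    rintro ⟨a, i⟩
    by_cases h : ∃ b, p a b
    · obtain ⟨b, hb⟩ := h
      rw [hg a b i hb, hg b a i (hs a b hb)]
    · rw [hg' a i h, hg' a _ h, Bool.not_not]
  refine ⟨hinv.toPerm, Equiv.ext fun x => hinv x, ?_, hg⟩
  rintro ⟨a, i⟩ hfix
  change g (a, i) = (a, i) at hfix
  by_cases h : ∃ b, p a b
  · obtain ⟨b, hb⟩ := h
    rw [hg a b i hb, Prod.mk.injEq] at hfix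
    exact hi a (hfix.1 ▸ hb)
  · rw [hg' a i h, Prod.mk.injEq] at hfix
    cases i <;> simp at hfix

theorem exists_two_coloring_of_matchings {α : Type} {p q : α → α → Prop}
    (hps : ∀ a b, p a b → p b a) (hpi : ∀ a, ¬ p a a) (hpm : ∀ a b c, p a b → p a c → b = c)
    (hqs : ∀ a b, q a b → q b a) (hqi : ∀ a, ¬ q a a) (hqm : ∀ a b c, q a b → q a c → b = c) :
    ∃ f : α → Bool, ∀ a b, p a b ∨ q a b → f a ≠ f b := by
  obtain ⟨P, hP1, hP2, hP3⟩ := exists_involution_of_matching hps hpi hpm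
  obtain ⟨Q, hQ1, hQ2, hQ3⟩ := exists_involution_of_matching hqs hqi hqm
  obtain ⟨c, hc⟩ := exists_two_coloring_of_involutions P Q hP1 hQ1 hP2 hQ2
  refine ⟨fun a => c (a, true), fun a b hab => ?_⟩
  rcases hab with hab | hab
  · have := (hc (a, true)).1
    rwa [hP3 a b true hab] at this
  · have := (hc (a, true)).2
    rwa [hQ3 a b true hab] at this

/-! ### The line graph of the Heawood graph -/

/-- The point of the flag `e` of the Fano plane. -/
def flagPoint (e : Fin 21) : ℕ := e.val / 3

/-- The line of the flag `e` of the Fano plane: the flag `3 * i + j` consists of the point `i` and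
the line `i + d` modulo `7`, where `d` is the `j`-th element of the difference set `{0, 1, 3}`. -/
def flagLine (e : Fin 21) : ℕ := (e.val / 3 + e.val % 3 * (e.val % 3 + 1) / 2) % 7

/-- The line graph of the Heawood graph: its vertices are the `21` flags of the Fano plane, and two
flags are adjacent if they share their point or their line. -/
def heawoodLineGraph : SimpleGraph (Fin 21) where
  Adj e f := e ≠ f ∧ (flagPoint e = flagPoint f ∨ flagLine e = flagLine f)
  symm := ⟨fun _ _ h => ⟨h.1.symm, h.2.imp Eq.symm Eq.symm⟩⟩
  loopless := ⟨fun _ h => h.1 rfl⟩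

instance : DecidableRel heawoodLineGraph.Adj := fun e f =>
  inferInstanceAs (Decidable (e ≠ f ∧ (flagPoint e = flagPoint f ∨ flagLine e = flagLine f)))

theorem heawoodLineGraph_eq_of_common : ∀ a b c : Fin 21, a ≠ b → heawoodLineGraph.Adj a c →
    heawoodLineGraph.Adj b c → ∀ d, heawoodLineGraph.Adj a d → heawoodLineGraph.Adj b d →
    c = d := by
  decide +kernel

theorem heawoodLineGraph_mod_ne : ∀ e f : Fin 21, heawoodLineGraph.Adj e f →
    e.val % 3 ≠ f.val % 3 := by
  decide +kernel

theorem flag_ext : ∀ e f : Fin 21, flagPoint e = flagPoint f → flagLine e = flagLine f →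
    e = f := by
  decide +kernel

theorem chromaticNumber_eq_cliqueNum_of {α : Type} [Finite α] {G : SimpleGraph α} {k : ℕ}
    (hc : G.Colorable k) {t : Finset α} (ht : G.IsNClique k t) :
    G.chromaticNumber = (G.cliqueNum : ℕ∞) := by
  refine le_antisymm (hc.chromaticNumber_le.trans ?_) G.cliqueNum_le_chromaticNumber
  rw [← ht.card_eq]
  exact_mod_cast ht.isClique.card_le_cliqueNum

/-- Induced subgraphs of the line graph of the Heawood graph are perfect. If three of the chosen
flags share a point or a line, they form a triangle and `e ↦ e % 3` is a 3-colouring; otherwise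
sharing a point and sharing a line are two matchings, and the graph is bipartite. -/
theorem isPerfect_comap_heawoodLineGraph {n : ℕ} (φ : Fin n ↪ Fin 21) :
    IsPerfect (heawoodLineGraph.comap φ) := by
  intro s
  set H := (heawoodLineGraph.comap φ).induce s with hH
  let ψ : s ↪ Fin 21 := (Function.Embedding.subtype _).trans φ
  have hadj : ∀ a b : s, H.Adj a b ↔ heawoodLineGraph.Adj (ψ a) (ψ b) := fun a b => Iff.rfl
  have hclique : ∀ a b c : s, H.Adj a b → H.Adj b c → H.Adj a c →
      H.chromaticNumber = (H.cliqueNum : ℕ∞) := by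
    intro a b c hab hbc hac
    refine chromaticNumber_eq_cliqueNum_of (k := 3) ?_ (t := {a, b, c})
      (SimpleGraph.is3Clique_triple_iff.2 ⟨hab, hac, hbc⟩)
    refine ⟨SimpleGraph.Coloring.mk
      (fun v => (⟨(ψ v).val % 3, Nat.mod_lt _ (by norm_num)⟩ : Fin 3)) ?_⟩
    intro v w hvw h
    exact heawoodLineGraph_mod_ne _ _ ((hadj v w).1 hvw) (congrArg Fin.val h)
  by_cases h3 : ∃ a b c : s, a ≠ b ∧ a ≠ c ∧ b ≠ c ∧
      ((flagPoint (ψ a) = flagPoint (ψ b) ∧ flagPoint (ψ a) = flagPoint (ψ c)) ∨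
        (flagLine (ψ a) = flagLine (ψ b) ∧ flagLine (ψ a) = flagLine (ψ c)))
  · obtain ⟨a, b, c, hab, hac, hbc, h⟩ := h3
    have hab := ψ.injective.ne hab
    have hac := ψ.injective.ne hac
    have hbc := ψ.injective.ne hbc
    rcases h with h | h
    · exact hclique a b c ⟨hab, Or.inl h.1⟩ ⟨hbc, Or.inl (h.1.symm.trans h.2)⟩
        ⟨hac, Or.inl h.2⟩
    · exact hclique a b c ⟨hab, Or.inr h.1⟩ ⟨hbc, Or.inr (h.1.symm.trans h.2)⟩
        ⟨hac, Or.inr h.2⟩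
  by_cases h2 : ∃ a b : s, H.Adj a b
  · obtain ⟨a, b, hab⟩ := h2
    refine chromaticNumber_eq_cliqueNum_of (k := 2) ?_ (t := {a, b}) ⟨?_, card_pair hab.ne⟩
    · obtain ⟨f, hf⟩ := exists_two_coloring_of_matchings
        (p := fun a b : s => a ≠ b ∧ flagPoint (ψ a) = flagPoint (ψ b))
        (q := fun a b : s => a ≠ b ∧ flagLine (ψ a) = flagLine (ψ b))
        (fun a b h => ⟨h.1.symm, h.2.symm⟩) (fun a h => h.1 rfl)
        (fun a b c hb hc => by
          by_contra hbc
          exact h3 ⟨a, b, c, hb.1, hc.1, hbc, Or.inl ⟨hb.2, hc.2⟩⟩)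
        (fun a b h => ⟨h.1.symm, h.2.symm⟩) (fun a h => h.1 rfl)
        (fun a b c hb hc => by
          by_contra hbc
          exact h3 ⟨a, b, c, hb.1, hc.1, hbc, Or.inr ⟨hb.2, hc.2⟩⟩)
      have hcol : H.Coloring Bool := SimpleGraph.Coloring.mk f fun {v w} hvw =>
        hf v w (hvw.2.imp (fun h => ⟨hvw.ne, h⟩) (fun h => ⟨hvw.ne, h⟩))
      simpa using hcol.colorable
    · rw [coe_pair, SimpleGraph.isClique_iff, Set.pairwise_pair]
      exact fun _ => ⟨hab, hab.symm⟩
  push Not at h2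
  by_cases h1 : Nonempty s
  · obtain ⟨a⟩ := h1
    refine chromaticNumber_eq_cliqueNum_of (k := 1) ?_ (t := {a}) ⟨by simp, by simp⟩
    exact ⟨SimpleGraph.Coloring.mk (fun _ => 0) fun {v w} hvw => absurd hvw (h2 v w)⟩
  · rw [not_nonempty_iff] at h1
    refine chromaticNumber_eq_cliqueNum_of (k := 0) ?_ (t := ∅) ⟨by simp, by simp⟩
    exact ⟨SimpleGraph.Coloring.mk (fun v => isEmptyElim v) fun {v w} hvw => absurd hvw (h2 v w)⟩

/-- If `g` takes each value at most twice on `S`, and `A` contains the elements of `S` at which `g`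
takes a repeated value, then a singleton fibre contributes `2` to the left side and at least `2` to
the right, and a fibre of size two contributes `4` to both. -/
theorem two_mul_card_le {ι : Type} {S A : Finset ι} (g : ι → ℕ) (hAS : A ⊆ S)
    (hA : ∀ e ∈ S, ∀ f ∈ S, f ≠ e → g f = g e → e ∈ A)
    (h : ∀ e ∈ S, ∀ a ∈ S, ∀ b ∈ S, a ≠ e → b ≠ e → g a = g e → g b = g e → a = b) :
    2 * S.card ≤ 2 * (S.image g).card + A.card := by
  classical
  have hmaps : ∀ e ∈ S, g e ∈ S.image g := fun e he => mem_image_of_mem g he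
  rw [card_eq_sum_card_fiberwise (f := g) (t := S.image g) hmaps,
    card_eq_sum_card_fiberwise (f := g) (s := A) (t := S.image g)
      (fun e he => hmaps e (hAS he)),
    mul_sum, mul_comm 2 (S.image g).card, ← smul_eq_mul, ← sum_const, ← sum_add_distrib]
  refine sum_le_sum fun p hp => ?_
  obtain ⟨e, he, rfl⟩ := mem_image.1 hp
  set F := S.filter fun a => g a = g e with hF
  have heF : e ∈ F := mem_filter.2 ⟨he, rfl⟩
  have h1 : (F.erase e).card ≤ 1 := by
    rw [card_le_one]
    intro a ha b hb
    rw [mem_erase, hF, mem_filter] at ha hb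
    exact h e he a ha.2.1 b hb.2.1 ha.1 hb.1 ha.2.2 hb.2.2
  rw [card_erase_of_mem heF] at h1
  by_cases h2 : F.card ≤ 1
  · omega
  · have hsub : F ⊆ A.filter fun a => g a = g e := by
      intro a ha
      obtain ⟨b, hb, hba⟩ := exists_mem_ne (not_le.1 h2) a
      rw [hF, mem_filter] at ha hb
      exact mem_filter.2 ⟨hA a ha.1 b hb.1 hba (hb.2.trans ha.2.symm), ha.2⟩
    have := card_le_card hsub
    omega

/-- A sparse set of flags is a disjoint union of paths with at most two edges in the Heawood graph,
so it covers at least `3 / 2` of the `14` vertices per flag. -/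
theorem card_le_nine_of_isSparse {S : Finset (Fin 21)} (hS : IsSparse heawoodLineGraph 1 S) :
    S.card ≤ 9 := by
  rw [isSparse_one_iff] at hS
  set A := S.filter fun e => ∃ f ∈ S, f ≠ e ∧ flagPoint f = flagPoint e
  set B := S.filter fun e => ∃ f ∈ S, f ≠ e ∧ flagLine f = flagLine e
  have h1 := two_mul_card_le (A := A) flagPoint (filter_subset _ _)
    (fun e he f hf hne h => mem_filter.2 ⟨he, f, hf, hne, h⟩) fun e he a ha b hb hae hbe h h' =>
      hS e he a ha b hb ⟨hae.symm, Or.inl h.symm⟩ ⟨hbe.symm, Or.inl h'.symm⟩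
  have h2 := two_mul_card_le (A := B) flagLine (filter_subset _ _)
    (fun e he f hf hne h => mem_filter.2 ⟨he, f, hf, hne, h⟩) fun e he a ha b hb hae hbe h h' =>
      hS e he a ha b hb ⟨hae.symm, Or.inr h.symm⟩ ⟨hbe.symm, Or.inr h'.symm⟩
  have hdisj : Disjoint A B := by
    rw [disjoint_left]
    intro e hA hB
    obtain ⟨he, f, hf, hfe, hf'⟩ := mem_filter.1 hA
    obtain ⟨_, f', hf1, hfe', hf1'⟩ := mem_filter.1 hB
    obtain rfl := hS e he f hf f' hf1 ⟨hfe.symm, Or.inl hf'.symm⟩ ⟨hfe'.symm, Or.inr hf1'.symm⟩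
    exact hfe (flag_ext _ _ hf' hf1')
  have h3 : A.card + B.card ≤ S.card := by
    rw [← card_union_of_disjoint hdisj]
    exact card_le_card (union_subset (filter_subset _ _) (filter_subset _ _))
  have himage : ∀ g : Fin 21 → ℕ, (∀ e, g e < 7) → (S.image g).card ≤ 7 := fun g hg => by
    have : S.image g ⊆ range 7 := by
      intro x hx
      obtain ⟨e, _, rfl⟩ := mem_image.1 hx
      exact mem_range.2 (hg e)
    simpa using card_le_card this
  have h4 := himage flagPoint fun e => by
    have := e.isLt
    rw [flagPoint]
    omega
  have h5 := himage flagLine fun e => Nat.mod_lt _ (by norm_num)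
  omega

/-- A dense set of four vertices contains a 4-cycle. -/
theorem exists_common_of_isDense {α : Type} {G : SimpleGraph α} {D : Finset α} (hD : D.card = 4)
    (hd : IsDense G 1 D) : ∃ a b c d, a ≠ b ∧ c ≠ d ∧ G.Adj a c ∧ G.Adj b c ∧ G.Adj a d ∧
      G.Adj b d := by
  classical
  rw [IsDense, isSparse_one_iff] at hd
  have key : ∀ v ∈ D, ∀ a ∈ D, ∀ b ∈ D, v ≠ a → v ≠ b → a ≠ b → ¬ G.Adj v a → G.Adj v b := by
    intro v hv a ha b hb hva hvb hab h1
    by_contra h2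
    exact hab (hd v hv a ha b hb ⟨hva, h1⟩ ⟨hvb, h2⟩)
  -- Both ends of a non-adjacent pair are adjacent to the other two vertices.
  have hpair : ∀ p ∈ D, ∀ q ∈ D, ∀ r ∈ D, ∀ s ∈ D, p ≠ q → p ≠ r → p ≠ s → q ≠ r → q ≠ s →
      r ≠ s → ¬ G.Adj p q → ∃ a b c d, a ≠ b ∧ c ≠ d ∧ G.Adj a c ∧ G.Adj b c ∧ G.Adj a d ∧
        G.Adj b d := by
    intro p hp q hq r hr s hs hpq hpr hps hqr hqs hrs h
    have h' : ¬ G.Adj q p := fun h1 => h h1.symm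
    exact ⟨p, q, r, s, hpq, hrs, key p hp q hq r hr hpq hpr hqr h,
      key q hq p hp r hr hpq.symm hqr hpr h', key p hp q hq s hs hpq hps hqs h,
      key q hq p hp s hs hpq.symm hqs hps h'⟩
  obtain ⟨a, b, c, d, hab, hac, had, hbc, hbd, hcd, hD'⟩ := card_eq_four.1 hD
  have ma : a ∈ D := by simp [hD']
  have mb : b ∈ D := by simp [hD']
  have mc : c ∈ D := by simp [hD']
  have md : d ∈ D := by simp [hD']
  by_cases h1 : G.Adj a c
  · by_cases h2 : G.Adj b c
    · by_cases h3 : G.Adj a d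
      · by_cases h4 : G.Adj b d
        · exact ⟨a, b, c, d, hab, hcd, h1, h2, h3, h4⟩
        · exact hpair b mb d md a ma c mc hbd hab.symm hbc had.symm hcd.symm hac h4
      · exact hpair a ma d md b mb c mc had hab hac hbd.symm hcd.symm hbc h3
    · exact hpair b mb c mc a ma d md hbc hab.symm hbd hac.symm hcd had h2
  · exact hpair a ma c mc b mb d md hac hab had hbc.symm hcd hbd h1

theorem notMem_ramseyOrders {n : ℕ} (hn : n ≤ 21) :
    n ∉ ramseyOrders perfectGraphs 1 4 10 := by
  intro h
  let φ : Fin n ↪ Fin 21 := Fin.castLEEmb hn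
  rcases h _ (isPerfect_comap_heawoodLineGraph φ) with ⟨D, hD, hd⟩ | ⟨S, hS, hs⟩
  · obtain ⟨a, b, c, d, hab, hcd, h1, h2, h3, h4⟩ := exists_common_of_isDense hD hd
    exact hcd (φ.injective
      (heawoodLineGraph_eq_of_common _ _ _ (φ.injective.ne hab) h1 h2 _ h3 h4))
  · have := card_le_nine_of_isSparse (hs.map φ)
    rw [card_map] at this
    omega

end LowerBound

end DefectiveRamsey

theorem theorem3p3 :
    DefectiveRamsey.IsRamseyNumber DefectiveRamsey.perfectGraphs 1 4 10 22 := by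
  refine ⟨DefectiveRamsey.mem_ramseyOrders_twentytwo, fun n hn => ?_⟩
  by_contra h
  exact DefectiveRamsey.notMem_ramseyOrders (by omega) hn
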